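/- For a closed operator $T$ in a Hilbert space, let $\sigma_{\mathrm{ess}}(T):=\sigma(T)\setminus\sigma_{\mathrm{disc}}(T)$ be its (Browder) essential spectrum, where $\sigma_{\mathrm{disc}}(T)$ is the set of those eigenvalues $\lambda$ of $T$ that are isolated points of $\sigma(T)$, have finite algebraic multiplicity (that is, $\bigcup_{n\ge1}\ker (T-\lambda)^n$ is finite-dimensional), and for which the range of $T-\lambda$ is closed. Let $H$ be the operator $H\psi=-\psi''+i\,\mathrm{sgn}(x)\,\psi$ in $L^2(\mathbb{R})$ with domain $W^{2,2}(\mathbb{R})$. For a function $V\in L^1(\mathbb{R})$ (possibly complex-valued) and $\varepsilon\in\mathbb{R}$, let $H_\varepsilon=H\,\dot{+}\,\varepsilon V$ be the operator in $L^2(\mathbb{R})$ associated with the closed sectorial form $$h_\varepsilon(\psi,\phi)=\int_{\mathbb{R}}\psi'\,\overline{\phi'}\,dx+i\int_0^{+\infty}\psi\,\overline{\phi}\,dx-i\int_{-\infty}^0\psi\,\overline{\phi}\,dx+\varepsilon\int_{\mathbb{R}}V\,\psi\,\overline{\phi}\,dx,\qquad \psi,\phi\in W^{1,2}(\mathbb{R}),$$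 that is, $\psi$ belongs to the domain of $H_\varepsilon$ and $H_\varepsilon\psi=\eta$ if and only if $\psi\in W^{1,2}(\mathbb{R})$, $\eta\in L^2(\mathbb{R})$ and $h_\varepsilon(\psi,\phi)=\int_{\mathbb{R}}\eta\,\overline{\phi}\,dx$ for all $\phi\in W^{1,2}(\mathbb{R})$. Then, for every $V\in L^1(\mathbb{R})$ and every $\varepsilon\in\mathbb{R}$, $$\sigma_{\mathrm{ess}}(H_\varepsilon)=\sigma_{\mathrm{ess}}(H)=[0,+\infty)+i\,\{-1,+1\}.$$ -/

import Mathlib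

noncomputable section

open MeasureTheory Complex TemperedDistribution
open scoped LineDeriv SchwartzMap FourierTransform ENNReal

/-! ### Spectral notions for unbounded operators -/

namespace UnboundedOp

variable {E : Type*} [NormedAddCommGroup E] [NormedSpace ℂ E]

/-- The operator `T - z`, defined on the domain of `T`. -/
def shift (T : E →ₗ.[ℂ] E) (z : ℂ) : T.domain →ₗ[ℂ] E :=
  T.toFun - z • T.domain.subtype

/-- The resolvent set: those `z` for which `T - z` is a bijection from the domain of `T` onto the
whole space with a bounded inverse. -/
def resolventSet (T : E →ₗ.[ℂ] E) : Set ℂ :=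
  {z | ∃ R : E →L[ℂ] E, (∀ x : T.domain, R (shift T z x) = x) ∧
    ∀ y : E, ∃ h : R y ∈ T.domain, shift T z ⟨R y, h⟩ = y}

/-- The spectrum, the complement of the resolvent set. -/
def spectrum (T : E →ₗ.[ℂ] E) : Set ℂ := (resolventSet T)ᶜ

/-- `lam` is an eigenvalue of `T`. -/
def IsEigenvalue (T : E →ₗ.[ℂ] E) (lam : ℂ) : Prop :=
  ∃ x : T.domain, x ≠ 0 ∧ T x = lam • (x : E)

/-- The kernel of the `n`-th power of the unbounded operator `T - lam`: a vector lies in the kernel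
of `(T - lam) ^ (n + 1)` when it is in the domain of `T` and is sent by `T - lam` into the kernel of
`(T - lam) ^ n`. -/
def kerPow (T : E →ₗ.[ℂ] E) (lam : ℂ) : ℕ → Submodule ℂ E
  | 0 => ⊥
  | n + 1 => ((kerPow T lam n).comap (shift T lam)).map T.domain.subtype

/-- The root subspace of `T` at `lam` (the union of the increasing sequence of the kernels of the
powers of `T - lam`); its dimension is the algebraic multiplicity of `lam`. -/
def rootSpace (T : E →ₗ.[ℂ] E) (lam : ℂ) : Submodule ℂ E := ⨆ n, kerPow T lam n

/-- The discrete spectrum: the eigenvalues of finite algebraic multiplicity that are isolated points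
of the spectrum and for which `T - lam` has closed range. -/
def discreteSpectrum (T : E →ₗ.[ℂ] E) : Set ℂ :=
  {lam | IsEigenvalue T lam ∧ (∃ r > 0, spectrum T ∩ Metric.ball lam r = {lam}) ∧
    FiniteDimensional ℂ (rootSpace T lam) ∧ IsClosed (Set.range (shift T lam))}

/-- The (Browder) essential spectrum. -/
def essentialSpectrum (T : E →ₗ.[ℂ] E) : Set ℂ := spectrum T \ discreteSpectrum T

end UnboundedOp

/-! ### Sobolev spaces on the line -/

namespace StepSchrodinger

/-- The Hilbert space `L²(ℝ)` of complex-valued functions. -/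
abbrev L2 : Type := Lp ℂ 2 (volume : Measure ℝ)

/-- `v ∈ L²(ℝ)` is the derivative of `u ∈ L²(ℝ)` in the sense of (tempered) distributions,
that is `∫ u φ' = -∫ v φ` for all Schwartz functions `φ`. For `u, v ∈ L²(ℝ)` this is the same as
being a weak derivative tested against compactly supported smooth functions, since these are dense
in the Schwartz space. -/
def IsWeakDeriv (u v : L2) : Prop := ∂_{(1 : ℝ)} (u : 𝓢'(ℝ, ℂ)) = (v : 𝓢'(ℝ, ℂ))

theorem IsWeakDeriv.unique {u v w : L2} (hv : IsWeakDeriv u v) (hw : IsWeakDeriv u w) : v = w := by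
  have h := LinearMap.ker_eq_bot.mp
    (Lp.ker_toTemperedDistributionCLM_eq_bot (F := ℂ) (μ := (volume : Measure ℝ)) (p := 2))
  exact h (hv.symm.trans hw)

theorem IsWeakDeriv.add {u u' v v' : L2} (h : IsWeakDeriv u v) (h' : IsWeakDeriv u' v') :
    IsWeakDeriv (u + u') (v + v') := by
  unfold IsWeakDeriv at *
  rw [← Lp.toTemperedDistributionCLM_apply, ← Lp.toTemperedDistributionCLM_apply, map_add, map_add,
    LineDeriv.lineDerivOp_add]
  simp [h, h']

theorem IsWeakDeriv.smul {u v : L2} (c : ℂ) (h : IsWeakDeriv u v) :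
    IsWeakDeriv (c • u) (c • v) := by
  unfold IsWeakDeriv at *
  rw [← Lp.toTemperedDistributionCLM_apply, ← Lp.toTemperedDistributionCLM_apply, map_smul,
    map_smul, LineDeriv.lineDerivOp_smul]
  simp [h]

/-- The Sobolev space `W^{1,2}(ℝ)`. -/
def W12 : Submodule ℂ L2 where
  carrier := {u | ∃ v : L2, IsWeakDeriv u v}
  zero_mem' := ⟨0, by
    unfold IsWeakDeriv
    rw [← Lp.toTemperedDistributionCLM_apply, map_zero, LineDeriv.lineDerivOp_zero]⟩
  add_mem' := fun ⟨v, hv⟩ ⟨w, hw⟩ => ⟨v + w, hv.add hw⟩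
  smul_mem' := fun c _ ⟨v, hv⟩ => ⟨c • v, hv.smul c⟩

/-- The weak derivative `W^{1,2}(ℝ) → L²(ℝ)`. -/
def weakDeriv : W12 →ₗ[ℂ] L2 where
  toFun u := u.2.choose
  map_add' u w := (u + w).2.choose_spec.unique (u.2.choose_spec.add w.2.choose_spec)
  map_smul' c u := (c • u).2.choose_spec.unique (u.2.choose_spec.smul c)

theorem isWeakDeriv_weakDeriv (u : W12) : IsWeakDeriv (u : L2) (weakDeriv u) := u.2.choose_spec

/-- The Sobolev space `W^{2,2}(ℝ)`. -/
def W22 : Submodule ℂ L2 := (W12.comap weakDeriv).map W12.subtype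

theorem W22_le_W12 : W22 ≤ W12 := Submodule.map_subtype_le _ _

theorem weakDeriv_mem_W12 (u : W22) : weakDeriv ⟨u, W22_le_W12 u.2⟩ ∈ W12 := by
  obtain ⟨w, hw, hwu⟩ := u.2
  have : w = ⟨u, W22_le_W12 u.2⟩ := Subtype.ext hwu
  rw [← this]
  exact hw

/-- The second weak derivative `W^{2,2}(ℝ) → L²(ℝ)`. -/
def weakDeriv2 : W22 →ₗ[ℂ] L2 :=
  weakDeriv ∘ₗ LinearMap.codRestrict W12 (weakDeriv ∘ₗ Submodule.inclusion W22_le_W12)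
    weakDeriv_mem_W12

/-! ### The operator `H` -/

theorem memLp_stepPotential :
    MemLp (fun x : ℝ => I * (Real.sign x : ℂ)) ∞ (volume : Measure ℝ) := by
  refine memLp_top_of_bound (C := 1) ?_ (Filter.Eventually.of_forall fun x => ?_)
  · have : Measurable Real.sign := by
      unfold Real.sign
      exact Measurable.ite measurableSet_Iio measurable_const
        (Measurable.ite measurableSet_Ioi measurable_const measurable_const)
    exact (measurable_const.mul (Complex.measurable_ofReal.comp this)).aestronglyMeasurable
  · rcases Real.sign_apply_eq x with h | h | h <;> simp [h]

/-- The potential `x ↦ i sgn x`, as a bounded function. -/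
def stepPotential : Lp ℂ ∞ (volume : Measure ℝ) := memLp_stepPotential.toLp _

/-- The operator `H ψ = -ψ'' + i sgn ψ` with domain `W^{2,2}(ℝ)`. -/
def opH : L2 →ₗ.[ℂ] L2 where
  domain := W22
  toFun :=
    { toFun := fun ψ => -weakDeriv2 ψ + stepPotential • (ψ : L2)
      map_add' := fun ψ φ => by
        rw [map_add, Submodule.coe_add, Lp.add_smul]; abel
      map_smul' := fun c ψ => by
        rw [map_smul, Submodule.coe_smul, ← Lp.smul_comm, RingHom.id_apply, smul_add, smul_neg] }

/-! ### The form of the perturbed operator -/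

theorem memSobolev_of_mem_W12 (u : W12) : MemSobolev 1 2 ((u : L2) : 𝓢'(ℝ, ℂ)) := by
  obtain ⟨u, v, huv⟩ := u
  -- the bounded Fourier multipliers that send `u` and `u'` to the Bessel potential of `u`
  set a : ℝ → ℂ := fun x => (((1 + ‖x‖ ^ 2) ^ (-1 / 2 : ℝ) : ℝ) : ℂ) with ha
  set b : ℝ → ℂ := fun x => ((x * (1 + ‖x‖ ^ 2) ^ (-1 / 2 : ℝ) : ℝ) : ℂ) with hb
  have ha1 : a.HasTemperateGrowth := by fun_prop
  have hb1 : b.HasTemperateGrowth := by fun_prop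
  have hpos : ∀ x : ℝ, 0 < 1 + ‖x‖ ^ 2 := fun x => by positivity
  have ha2 : ∃ C, ∀ x, ‖a x‖ ≤ C := ⟨1, fun x => by
    rw [ha, Complex.norm_real, Real.norm_of_nonneg (by positivity)]
    exact Real.rpow_le_one_of_one_le_of_nonpos (by simp [sq_nonneg]) (by norm_num)⟩
  have hb2 : ∃ C, ∀ x, ‖b x‖ ≤ C := ⟨1, fun x => by
    have h1 : (1 + ‖x‖ ^ 2) ^ (-1 / 2 : ℝ) = (Real.sqrt (1 + ‖x‖ ^ 2))⁻¹ := by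
      rw [Real.sqrt_eq_rpow, ← Real.rpow_neg (hpos x).le]; norm_num
    rw [hb, Complex.norm_real, norm_mul, h1, norm_inv, Real.norm_of_nonneg (Real.sqrt_nonneg _),
      ← div_eq_mul_inv, div_le_one (Real.sqrt_pos.2 (hpos x))]
    exact Real.le_sqrt_of_sq_le (by linarith)⟩
  have hu0 : MemSobolev 0 2 (u : 𝓢'(ℝ, ℂ)) := memSobolev_zero_iff.2 ⟨u, rfl⟩
  have hv0 : MemSobolev 0 2 (v : 𝓢'(ℝ, ℂ)) := memSobolev_zero_iff.2 ⟨v, rfl⟩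
  have h1 := (hu0.fourierMultiplierCLM_of_bounded ha1 ha2).add
    ((hv0.fourierMultiplierCLM_of_bounded hb1 hb2).smul (2 * Real.pi * I)⁻¹)
  suffices h : besselPotential ℝ ℂ 1 (u : 𝓢'(ℝ, ℂ)) =
      fourierMultiplierCLM ℂ a (u : 𝓢'(ℝ, ℂ)) +
        (2 * Real.pi * I)⁻¹ • fourierMultiplierCLM ℂ b (v : 𝓢'(ℝ, ℂ)) by
    rw [← h, memSobolev_zero_iff] at h1
    exact h1
  have hc : (2 * Real.pi * I : ℂ) ≠ 0 := by simp [Real.pi_ne_zero]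
  rw [← show ∂_{(1 : ℝ)} (u : 𝓢'(ℝ, ℂ)) = (v : 𝓢'(ℝ, ℂ)) from huv,
    lineDeriv_eq_fourierMultiplierCLM, map_smul, smul_smul, inv_mul_cancel₀ hc, one_smul,
    fourierMultiplierCLM_fourierMultiplierCLM_apply (by fun_prop) hb1, besselPotential]
  simp only [fourierMultiplierCLM_apply]
  rw [← FourierTransform.fourierInv_add, ← add_apply,
    ← smulLeftCLM_add ha1 (by fun_prop)]
  congr 3
  ext x
  simp only [ha, hb, Pi.add_apply, Pi.mul_apply]
  rw [← Complex.ofReal_mul, ← Complex.ofReal_add]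
  congr 1
  have h2 : (1 + ‖x‖ ^ 2) ^ (1 / 2 : ℝ) = (1 + ‖x‖ ^ 2) * (1 + ‖x‖ ^ 2) ^ (-1 / 2 : ℝ) := by
    nth_rewrite 2 [← Real.rpow_one (1 + ‖x‖ ^ 2)]
    rw [← Real.rpow_add (hpos x)]
    norm_num
  rw [h2]
  simp
  ring

/-- Functions in `W^{1,2}(ℝ)` are essentially bounded. -/
theorem exists_bound_of_mem_W12 (u : W12) : ∃ C : ℝ, ∀ᵐ x : ℝ, ‖(u : L2) x‖ ≤ C := by
  obtain ⟨w, hw⟩ := (memSobolev_of_mem_W12 u).fourier_memL1 (by simp)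
  have hwi : Integrable w volume := L1.integrable_coeFn w
  have hcont : Continuous (𝓕⁻ (w : ℝ → ℂ)) :=
    VectorFourier.fourierIntegral_continuous Real.continuous_fourierChar (by fun_prop) hwi
  have key : ∀ᵐ x : ℝ, (u : L2) x = 𝓕⁻ (w : ℝ → ℂ) x := by
    apply ae_eq_of_integral_contDiff_smul_eq
    · exact (Lp.memLp (u : L2)).locallyIntegrable (by norm_num)
    · exact hcont.locallyIntegrable
    · intro g hg hgc
      have hg₁ : HasCompactSupport (Complex.ofRealCLM ∘ g) := hgc.comp_left rfl
      have hg₂ : ContDiff ℝ ((⊤ : ℕ∞) : WithTop ℕ∞) (Complex.ofRealCLM ∘ g) :=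
        Complex.ofRealCLM.contDiff.comp hg
      set φ : 𝓢(ℝ, ℂ) := hg₁.toSchwartzMap hg₂
      have h1 : ((u : L2) : 𝓢'(ℝ, ℂ)) φ = (w : 𝓢'(ℝ, ℂ)) (𝓕⁻ φ) := by
        rw [← hw, TemperedDistribution.fourier_apply, FourierTransform.fourier_fourierInv_eq]
      rw [Lp.toTemperedDistribution_apply, Lp.toTemperedDistribution_apply] at h1
      have h2 : ∫ x, (𝓕⁻ φ) x • w x = ∫ x, φ x • 𝓕⁻ (w : ℝ → ℂ) x := by
        have h3 := VectorFourier.integral_fourierIntegral_smul_eq_flip (μ := volume) (ν := volume)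
          (L := -innerₗ ℝ) (f := φ) (g := w) Real.continuous_fourierChar (by fun_prop)
          φ.integrable hwi
        rw [SchwartzMap.fourierInv_coe]
        have h4 : (-innerₗ ℝ : ℝ →ₗ[ℝ] ℝ →ₗ[ℝ] ℝ).flip = -innerₗ ℝ := by
          ext; simp
        rw [h4] at h3
        exact h3
      rw [h2] at h1
      simpa [φ] using h1
  refine ⟨∫ x, ‖w x‖, key.mono fun x hx => ?_⟩
  rw [hx]
  exact VectorFourier.norm_fourierIntegral_le_integral_norm _ _ _ _ _

theorem integrable_mul_mul_conj {V : ℝ → ℂ} (hV : Integrable V) (ψ φ : W12) :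
    Integrable fun x => V x * (ψ : L2) x * starRingEnd ℂ ((φ : L2) x) := by
  obtain ⟨C, hC⟩ := exists_bound_of_mem_W12 ψ
  obtain ⟨D, hD⟩ := exists_bound_of_mem_W12 φ
  refine (hV.mul_bdd (Lp.aestronglyMeasurable _) hC).mul_bdd (c := D)
    (Complex.continuous_conj.comp_aestronglyMeasurable (Lp.aestronglyMeasurable _)) ?_
  filter_upwards [hD] with x hx
  simpa using hx

theorem integrable_mul_conj (ψ φ : L2) : Integrable fun x => ψ x * starRingEnd ℂ (φ x) := by
  simpa [mul_comm] using L2.integrable_inner (𝕜 := ℂ) φ ψ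

/-- The sesquilinear form `h_ε = h + ε v` on `W^{1,2}(ℝ)`, with
`h(ψ, φ) = ∫ ψ' conj φ' + i ∫_{x > 0} ψ conj φ - i ∫_{x < 0} ψ conj φ` and
`v(ψ, φ) = ∫ V ψ conj φ`. -/
def formH (V : ℝ → ℂ) (ε : ℝ) (ψ φ : W12) : ℂ :=
  (∫ x, weakDeriv ψ x * starRingEnd ℂ (weakDeriv φ x))
    + I * (∫ x in Set.Ioi (0 : ℝ), (ψ : L2) x * starRingEnd ℂ ((φ : L2) x))
    - I * (∫ x in Set.Iio (0 : ℝ), (ψ : L2) x * starRingEnd ℂ ((φ : L2) x))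
    + ε * ∫ x, V x * (ψ : L2) x * starRingEnd ℂ ((φ : L2) x)

theorem formH_add {V : ℝ → ℂ} (hV : Integrable V) (ε : ℝ) (ψ₁ ψ₂ φ : W12) :
    formH V ε (ψ₁ + ψ₂) φ = formH V ε ψ₁ φ + formH V ε ψ₂ φ := by
  have h1 : (∫ x, weakDeriv (ψ₁ + ψ₂) x * starRingEnd ℂ (weakDeriv φ x)) =
      (∫ x, weakDeriv ψ₁ x * starRingEnd ℂ (weakDeriv φ x)) +
        ∫ x, weakDeriv ψ₂ x * starRingEnd ℂ (weakDeriv φ x) := by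
    rw [← integral_add (integrable_mul_conj _ _) (integrable_mul_conj _ _), map_add]
    refine integral_congr_ae ?_
    filter_upwards [Lp.coeFn_add (weakDeriv ψ₁) (weakDeriv ψ₂)] with x hx
    rw [hx, Pi.add_apply, add_mul]
  have h2 : ∀ s : Set ℝ, (∫ x in s, ((ψ₁ + ψ₂ : W12) : L2) x * starRingEnd ℂ ((φ : L2) x)) =
      (∫ x in s, (ψ₁ : L2) x * starRingEnd ℂ ((φ : L2) x)) +
        ∫ x in s, (ψ₂ : L2) x * starRingEnd ℂ ((φ : L2) x) := fun s => by
    rw [← integral_add (integrable_mul_conj _ _).integrableOn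
      (integrable_mul_conj _ _).integrableOn]
    refine integral_congr_ae (ae_restrict_of_ae ?_)
    filter_upwards [Lp.coeFn_add (ψ₁ : L2) (ψ₂ : L2)] with x hx
    rw [Submodule.coe_add, hx, Pi.add_apply, add_mul]
  have h3 : (∫ x, V x * ((ψ₁ + ψ₂ : W12) : L2) x * starRingEnd ℂ ((φ : L2) x)) =
      (∫ x, V x * (ψ₁ : L2) x * starRingEnd ℂ ((φ : L2) x)) +
        ∫ x, V x * (ψ₂ : L2) x * starRingEnd ℂ ((φ : L2) x) := by
    rw [← integral_add (integrable_mul_mul_conj hV _ _) (integrable_mul_mul_conj hV _ _)]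
    refine integral_congr_ae ?_
    filter_upwards [Lp.coeFn_add (ψ₁ : L2) (ψ₂ : L2)] with x hx
    rw [Submodule.coe_add, hx, Pi.add_apply, mul_add, add_mul]
  unfold formH
  rw [h1, h2, h2, h3]
  ring

theorem formH_smul (V : ℝ → ℂ) (ε : ℝ) (c : ℂ) (ψ φ : W12) :
    formH V ε (c • ψ) φ = c * formH V ε ψ φ := by
  have h1 : (∫ x, weakDeriv (c • ψ) x * starRingEnd ℂ (weakDeriv φ x)) =
      c * ∫ x, weakDeriv ψ x * starRingEnd ℂ (weakDeriv φ x) := by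
    rw [← integral_const_mul, map_smul]
    refine integral_congr_ae ?_
    filter_upwards [Lp.coeFn_smul c (weakDeriv ψ)] with x hx
    rw [hx, Pi.smul_apply, smul_eq_mul, mul_assoc]
  have h2 : ∀ s : Set ℝ, (∫ x in s, ((c • ψ : W12) : L2) x * starRingEnd ℂ ((φ : L2) x)) =
      c * ∫ x in s, (ψ : L2) x * starRingEnd ℂ ((φ : L2) x) := fun s => by
    rw [← integral_const_mul]
    refine integral_congr_ae (ae_restrict_of_ae ?_)
    filter_upwards [Lp.coeFn_smul c (ψ : L2)] with x hx
    rw [Submodule.coe_smul, hx, Pi.smul_apply, smul_eq_mul, mul_assoc]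
  have h3 : (∫ x, V x * ((c • ψ : W12) : L2) x * starRingEnd ℂ ((φ : L2) x)) =
      c * ∫ x, V x * (ψ : L2) x * starRingEnd ℂ ((φ : L2) x) := by
    rw [← integral_const_mul]
    refine integral_congr_ae ?_
    filter_upwards [Lp.coeFn_smul c (ψ : L2)] with x hx
    rw [Submodule.coe_smul, hx, Pi.smul_apply, smul_eq_mul]
    ring
  unfold formH
  rw [h1, h2, h2, h3]
  ring

theorem dense_W12 : Dense (W12 : Set L2) := by
  refine (SchwartzMap.denseRange_toLpCLM (E := ℝ) (F := ℂ) (μ := volume) (p := 2)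
    (by norm_num)).mono ?_
  rintro _ ⟨f, rfl⟩
  refine ⟨(∂_{(1 : ℝ)} f).toLp 2, ?_⟩
  unfold IsWeakDeriv
  rw [SchwartzMap.toLpCLM_apply, Lp.toTemperedDistribution_toLp_eq,
    Lp.toTemperedDistribution_toLp_eq, lineDerivOp_toTemperedDistributionCLM_eq]

/-! ### The operator `H_ε` -/

/-- `η` represents the form at `ψ`: `h_ε(ψ, φ) = (η, φ)` for all `φ` in `W^{1,2}(ℝ)`, where
`(η, φ) = ∫ η conj φ`. -/
def Represents (V : ℝ → ℂ) (ε : ℝ) (ψ : W12) (η : L2) : Prop :=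
  ∀ φ : W12, formH V ε ψ φ = inner ℂ (φ : L2) η

theorem Represents.unique {V : ℝ → ℂ} {ε : ℝ} {ψ : W12} {η η' : L2} (h : Represents V ε ψ η)
    (h' : Represents V ε ψ η') : η = η' :=
  dense_W12.eq_of_inner_right ℂ fun φ hφ => (h ⟨φ, hφ⟩).symm.trans (h' ⟨φ, hφ⟩)

theorem Represents.add {V : ℝ → ℂ} (hV : Integrable V) {ε : ℝ} {ψ ψ' : W12} {η η' : L2}
    (h : Represents V ε ψ η) (h' : Represents V ε ψ' η') :
    Represents V ε (ψ + ψ') (η + η') := fun φ => by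
  rw [formH_add hV, h φ, h' φ, inner_add_right]

theorem Represents.smul {V : ℝ → ℂ} {ε : ℝ} {ψ : W12} {η : L2} (c : ℂ)
    (h : Represents V ε ψ η) : Represents V ε (c • ψ) (c • η) := fun φ => by
  rw [formH_smul, h φ, inner_smul_right]

/-- The domain of the operator associated with the form `h_ε`: the functions `ψ` in `W^{1,2}(ℝ)` for
which some `η` in `L²(ℝ)` satisfies `h_ε(ψ, φ) = (η, φ)` for all `φ` in `W^{1,2}(ℝ)`. -/
def domH {V : ℝ → ℂ} (hV : Integrable V) (ε : ℝ) : Submodule ℂ L2 where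
  carrier := {ψ | ∃ (hψ : ψ ∈ W12) (η : L2), Represents V ε ⟨ψ, hψ⟩ η}
  zero_mem' := ⟨W12.zero_mem, 0, fun φ => by
    have h := formH_smul V ε 0 0 φ
    rw [zero_smul, zero_mul] at h
    rw [inner_zero_right]
    exact h⟩
  add_mem' := fun {ψ ψ'} ⟨hψ, η, h⟩ ⟨hψ', η', h'⟩ => ⟨W12.add_mem hψ hψ', η + η', by
    have h2 : (⟨ψ + ψ', W12.add_mem hψ hψ'⟩ : W12) = ⟨ψ, hψ⟩ + ⟨ψ', hψ'⟩ := rfl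
    rw [h2]
    exact h.add hV h'⟩
  smul_mem' := fun c ψ ⟨hψ, η, h⟩ => ⟨W12.smul_mem c hψ, c • η, by
    have h2 : (⟨c • ψ, W12.smul_mem c hψ⟩ : W12) = c • ⟨ψ, hψ⟩ := rfl
    rw [h2]
    exact h.smul c⟩

theorem domH_le_W12 {V : ℝ → ℂ} (hV : Integrable V) (ε : ℝ) : domH hV ε ≤ W12 :=
  fun _ h => h.choose

theorem exists_represents {V : ℝ → ℂ} {hV : Integrable V} {ε : ℝ} (ψ : domH hV ε) :
    ∃ η : L2, Represents V ε (Submodule.inclusion (domH_le_W12 hV ε) ψ) η := ψ.2.choose_spec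

/-- The operator `H_ε = H ∔ ε V` associated with the form `h_ε`: it sends `ψ` to the unique `η` such
that `h_ε(ψ, φ) = (η, φ)` for all `φ` in `W^{1,2}(ℝ)`. -/
def opHPert {V : ℝ → ℂ} (hV : Integrable V) (ε : ℝ) : L2 →ₗ.[ℂ] L2 where
  domain := domH hV ε
  toFun :=
    { toFun := fun ψ => (exists_represents ψ).choose
      map_add' := fun ψ φ => by
        refine (exists_represents (ψ + φ)).choose_spec.unique ?_
        rw [map_add]
        exact (exists_represents ψ).choose_spec.add hV (exists_represents φ).choose_spec
      map_smul' := fun c ψ => by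
        refine (exists_represents (c • ψ)).choose_spec.unique ?_
        rw [map_smul]
        exact (exists_represents ψ).choose_spec.smul c }

end StepSchrodinger

end

noncomputable section

open MeasureTheory Complex TemperedDistribution
open scoped LineDeriv SchwartzMap FourierTransform ENNReal

/-! ### Bounded operators: invertibility modulo finite rank -/

namespace FormPencil

set_option linter.unusedSectionVars false

open Filter Topology ContinuousLinearMap

variable {X E : Type*} [NormedAddCommGroup X] [InnerProductSpace ℂ X] [CompleteSpace X]
  [NormedAddCommGroup E] [InnerProductSpace ℂ E] [CompleteSpace E]

/-! Both operators come from forms on $W^{1,2}(\mathbb R)$. By Riesz representation, the form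
shifted by $z$ becomes a bounded operator `pencil ι B z` on the form domain, and `IsAssociated`
transfers resolvent points, eigenvectors, Jordan chains and closed ranges from this operator to $T$.
An integrable potential enters as a Bochner integral of rank-one operators, hence as a norm limit of
finite rank operators (`potential_mem_closure`). Exchanging one integrable potential for another
therefore does not affect invertibility modulo finite rank.

Off the two half-lines, a suitable auxiliary integrable potential makes the shifted form operator
invertible (`exists_isUnit_pencil`), so for every potential it is invertible plus finite rank.
Locally, invertibility then amounts to the nonvanishing of a holomorphic determinant
(`schurMatrix`). This determinant does not vanish identically, because the leftward ray from $z$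
avoids the half-lines and reaches the region of coercivity. Its zeros are thus isolated, and their
order bounds the length of Jordan chains, so any spectrum there is discrete
(`IsAssociated.mem_discreteSpectrum`).

Conversely, slowly modulated plane waves supported on one side of the origin put both half-lines in
the spectrum (`add_mem_spectrum`). No point of a half-line is isolated, so none is discrete. -/

/-- The bounded operators of finite rank. -/
def finiteRank (X : Type*) [NormedAddCommGroup X] [NormedSpace ℂ X] : Submodule ℂ (X →L[ℂ] X) where
  carrier := {F | FiniteDimensional ℂ (LinearMap.range (F : X →ₗ[ℂ] X))}
  zero_mem' := by
    change FiniteDimensional ℂ (LinearMap.range (0 : X →ₗ[ℂ] X))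
    rw [LinearMap.range_zero]
    infer_instance
  add_mem' {F G} hF hG := by
    have : FiniteDimensional ℂ (LinearMap.range (F : X →ₗ[ℂ] X)) := hF
    have : FiniteDimensional ℂ (LinearMap.range (G : X →ₗ[ℂ] X)) := hG
    exact Submodule.finiteDimensional_of_le
      (LinearMap.range_add_le (F : X →ₗ[ℂ] X) (G : X →ₗ[ℂ] X))
  smul_mem' c F hF := by
    have : FiniteDimensional ℂ (LinearMap.range (F : X →ₗ[ℂ] X)) := hF
    refine Submodule.finiteDimensional_of_le (S₂ := LinearMap.range (F : X →ₗ[ℂ] X)) ?_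
    rintro _ ⟨x, rfl⟩
    exact ⟨c • x, by simp⟩

theorem mem_finiteRank {F : X →L[ℂ] X} :
    F ∈ finiteRank X ↔ FiniteDimensional ℂ (LinearMap.range (F : X →ₗ[ℂ] X)) := Iff.rfl

/-- Coordinates on the range give the factors; passing through $\mathbb C^n$ turns invertibility
into a determinant condition. -/
theorem exists_factorization_of_mem_finiteRank {F : X →L[ℂ] X} (hF : F ∈ finiteRank X) :
    ∃ (n : ℕ) (P : (Fin n → ℂ) →L[ℂ] X) (Q : X →L[ℂ] (Fin n → ℂ)), F = P ∘L Q := by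
  have := mem_finiteRank.1 hF
  set W := LinearMap.range (F : X →ₗ[ℂ] X)
  have e : W ≃L[ℂ] (Fin (Module.finrank ℂ W) → ℂ) :=
    ContinuousLinearEquiv.ofFinrankEq (by simp)
  refine ⟨Module.finrank ℂ W, W.subtypeL ∘L (e.symm : (Fin (Module.finrank ℂ W) → ℂ) →L[ℂ] W),
    (e : W →L[ℂ] (Fin (Module.finrank ℂ W) → ℂ)) ∘L F.codRestrict W fun x => ⟨x, rfl⟩, ?_⟩
  ext x
  simp only [comp_apply, ContinuousLinearEquiv.coe_coe, ContinuousLinearEquiv.symm_apply_apply]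
  rfl

/-- The first bound gives injectivity and closed range. The second makes the adjoint injective, so
the range is also dense. -/
theorem isUnit_of_bounded_below {A : X →L[ℂ] X} {c : ℝ} (hc : 0 < c)
    (h1 : ∀ x, c * ‖x‖ ≤ ‖A x‖) (h2 : ∀ x, c * ‖x‖ ≤ ‖adjoint A x‖) : IsUnit A := by
  have hA : AntilipschitzWith (Real.toNNReal c⁻¹) A := by
    refine AddMonoidHomClass.antilipschitz_of_bound A fun x => ?_
    rw [Real.coe_toNNReal _ (inv_nonneg.2 hc.le), ← div_eq_inv_mul, le_div_iff₀' hc]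
    exact h1 x
  have hclosed : IsClosed (LinearMap.range (A : X →ₗ[ℂ] X) : Set X) :=
    hA.isClosed_range A.uniformContinuous
  have hdense : (LinearMap.range (A : X →ₗ[ℂ] X))ᗮ = ⊥ := by
    rw [Submodule.eq_bot_iff]
    intro x hx
    have : adjoint A x = 0 := by
      rw [← inner_self_eq_zero (𝕜 := ℂ), adjoint_inner_right]
      exact (Submodule.mem_orthogonal _ _).1 hx _ ⟨_, rfl⟩
    have h := h2 x
    rw [this, norm_zero] at h
    exact norm_le_zero_iff.1 (by nlinarith [norm_nonneg x])
  have : CompleteSpace (LinearMap.range (A : X →ₗ[ℂ] X)) := hclosed.completeSpace_coe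
  have hsurj : Function.Surjective A :=
    LinearMap.range_eq_top.1 (Submodule.orthogonal_eq_bot_iff.1 hdense)
  exact ContinuousLinearMap.isUnit_iff_bijective.2 ⟨hA.injective, hsurj⟩

theorem isUnit_of_coercive {A : X →L[ℂ] X} {c : ℝ} (hc : 0 < c)
    (h : ∀ x, c * ‖x‖ ^ 2 ≤ (inner ℂ x (A x)).re) : IsUnit A := by
  have key : ∀ x y : X, c * ‖x‖ ^ 2 ≤ (inner ℂ x y).re → c * ‖x‖ ≤ ‖y‖ := fun x y hxy => by
    have h1 : (inner ℂ x y).re ≤ ‖x‖ * ‖y‖ := re_inner_le_norm (𝕜 := ℂ) x y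
    rcases (norm_nonneg x).eq_or_lt with h0 | h0
    · rw [← h0, mul_zero]
      exact norm_nonneg _
    · nlinarith
  refine isUnit_of_bounded_below hc (fun x => key _ _ (h x)) fun x => key _ _ ?_
  rw [adjoint_inner_right, ← inner_conj_symm, conj_re]
  exact h x

/-- Units are open: if $F$ is close enough to $K$, the remainder $K-F$ can be absorbed into $C$. -/
theorem exists_add_finiteRank {C K : X →L[ℂ] X} (hC : IsUnit C)
    (hK : K ∈ (finiteRank X).topologicalClosure) :
    ∃ C' F : X →L[ℂ] X, IsUnit C' ∧ F ∈ finiteRank X ∧ C + K = C' + F := by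
  have hopen : IsOpen {F : X →L[ℂ] X | IsUnit (C + (K - F))} :=
    Units.isOpen.preimage (by fun_prop)
  obtain ⟨F, hF, hF'⟩ := mem_closure_iff.1 hK _ hopen (by simpa using hC)
  exact ⟨C + (K - F), F, hF, hF', by abel⟩

/-! ### Finite rank perturbations of an invertible operator -/

section Factor

variable {n : ℕ} (C : X →L[ℂ] X) (P : (Fin n → ℂ) →L[ℂ] X) (Q : X →L[ℂ] (Fin n → ℂ))

/-- The matrix `1 + Q C⁻¹ P` whose determinant decides whether `C + P Q` is invertible. -/
def schurMatrix : Matrix (Fin n) (Fin n) ℂ :=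
  1 + LinearMap.toMatrix' ((Q ∘L Ring.inverse C ∘L P : (Fin n → ℂ) →L[ℂ] (Fin n → ℂ)) :
    (Fin n → ℂ) →ₗ[ℂ] (Fin n → ℂ))

theorem schurMatrix_mulVec (v : Fin n → ℂ) :
    (schurMatrix C P Q).mulVec v = v + Q (Ring.inverse C (P v)) := by
  rw [schurMatrix, Matrix.add_mulVec, Matrix.one_mulVec, LinearMap.toMatrix'_mulVec]
  rfl

variable {C P Q}

theorem inverse_apply_self (hC : IsUnit C) (x : X) : Ring.inverse C (C x) = x := by
  change (Ring.inverse C * C) x = x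
  rw [Ring.inverse_mul_cancel _ hC]
  rfl

theorem apply_inverse_self (hC : IsUnit C) (x : X) : C (Ring.inverse C x) = x := by
  change (C * Ring.inverse C) x = x
  rw [Ring.mul_inverse_cancel _ hC]
  rfl

/-- Applying $QC^{-1}$ to $(C+PQ)x=y$ leaves an equation for $Qx$ alone. This reduction to $\mathbb
C^n$ underlies the invertibility, range and Jordan chain arguments. -/
theorem schurMatrix_mulVec_apply (hC : IsUnit C) (x : X) :
    (schurMatrix C P Q).mulVec (Q x) = Q (Ring.inverse C ((C + P ∘L Q) x)) := by
  rw [schurMatrix_mulVec, add_apply, map_add, map_add, inverse_apply_self hC]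
  rfl

theorem isUnit_of_det_ne_zero (hC : IsUnit C) (hd : (schurMatrix C P Q).det ≠ 0) :
    IsUnit (C + P ∘L Q) := by
  set M := schurMatrix C P Q
  have hM : IsUnit M.det := isUnit_iff_ne_zero.2 hd
  refine ContinuousLinearMap.isUnit_iff_bijective.2
    ⟨(injective_iff_map_eq_zero _).2 fun x hx => ?_, fun y => ?_⟩
  · have h1 : M.mulVec (Q x) = 0 := by
      rw [schurMatrix_mulVec_apply hC, hx, map_zero, map_zero]
    have h2 : Q x = 0 := by
      rw [← Matrix.one_mulVec (Q x), ← Matrix.nonsing_inv_mul M hM, ← Matrix.mulVec_mulVec, h1,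
        Matrix.mulVec_zero]
    rw [add_apply, comp_apply, h2, map_zero, add_zero] at hx
    rw [← inverse_apply_self hC x, hx, map_zero]
  -- Solve the reduced equation for the expected value $v$ of $Qx$; then $x=C^{-1}(y-Pv)$ indeed has
  -- $Qx=v$.
  · set v := M⁻¹.mulVec (Q (Ring.inverse C y)) with hv
    have h1 : v + Q (Ring.inverse C (P v)) = Q (Ring.inverse C y) := by
      rw [← schurMatrix_mulVec, hv, Matrix.mulVec_mulVec, Matrix.mul_nonsing_inv M hM,
        Matrix.one_mulVec]
    refine ⟨Ring.inverse C y - Ring.inverse C (P v), ?_⟩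
    have h2 : Q (Ring.inverse C y) - Q (Ring.inverse C (P v)) = v := by
      rw [← h1]; abel
    rw [add_apply, comp_apply, map_sub, map_sub, apply_inverse_self hC, apply_inverse_self hC, h2]
    abel

/-- A null vector $v$ of the matrix lifts to $x=C^{-1}Pv$. Since $Qx=-v$, the lift is nonzero. -/
theorem exists_ne_zero_of_det_eq_zero (hC : IsUnit C) (hd : (schurMatrix C P Q).det = 0) :
    ∃ x, x ≠ 0 ∧ (C + P ∘L Q) x = 0 := by
  obtain ⟨v, hv0, hv⟩ := Matrix.exists_mulVec_eq_zero_iff.2 hd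
  rw [schurMatrix_mulVec] at hv
  have h : Q (Ring.inverse C (P v)) = -v := (neg_eq_of_add_eq_zero_right hv).symm
  refine ⟨Ring.inverse C (P v), fun h0 => hv0 ?_, ?_⟩
  · rw [h0, map_zero] at h
    exact neg_eq_zero.1 h.symm
  · rw [add_apply, comp_apply, h, apply_inverse_self hC, map_neg, add_neg_cancel]

theorem isUnit_iff_det_ne_zero (hC : IsUnit C) :
    IsUnit (C + P ∘L Q) ↔ (schurMatrix C P Q).det ≠ 0 := by
  refine ⟨fun h hd => ?_, isUnit_of_det_ne_zero hC⟩
  obtain ⟨x, hx0, hx⟩ := exists_ne_zero_of_det_eq_zero hC hd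
  exact hx0 ((ContinuousLinearMap.isUnit_iff_bijective.1 h).1 (hx.trans (map_zero _).symm))

theorem eq_zero_of_apply_eq_zero (hC : IsUnit C) {x : X} (hx : (C + P ∘L Q) x = 0)
    (hQ : Q x = 0) : x = 0 := by
  rw [add_apply, comp_apply, hQ, map_zero, add_zero] at hx
  rw [← inverse_apply_self hC x, hx, map_zero]

/-- Solvability is decided in $\mathbb C^n$, so the range is the preimage of a finite-dimensional
subspace under a continuous map; this is why it is closed. -/
theorem mem_range_add_comp_iff (hC : IsUnit C) (y : X) :
    y ∈ Set.range (C + P ∘L Q) ↔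
      Q (Ring.inverse C y) ∈ LinearMap.range (schurMatrix C P Q).mulVecLin := by
  constructor
  · rintro ⟨x, rfl⟩
    exact ⟨Q x, schurMatrix_mulVec_apply hC x⟩
  · rintro ⟨v, hv⟩
    rw [Matrix.mulVecLin_apply, schurMatrix_mulVec] at hv
    refine ⟨Ring.inverse C y - Ring.inverse C (P v), ?_⟩
    have h2 : Q (Ring.inverse C y) - Q (Ring.inverse C (P v)) = v := by
      rw [← hv]; abel
    rw [add_apply, comp_apply, map_sub, map_sub, apply_inverse_self hC, apply_inverse_self hC, h2]
    abel

theorem isClosed_range_add_comp (hC : IsUnit C) : IsClosed (Set.range (C + P ∘L Q)) := by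
  have h : Set.range (C + P ∘L Q) = (fun y => Q (Ring.inverse C y)) ⁻¹'
      (LinearMap.range (schurMatrix C P Q).mulVecLin : Set (Fin n → ℂ)) :=
    Set.ext (mem_range_add_comp_iff hC)
  rw [h]
  exact (Submodule.closed_of_finiteDimensional _).preimage (by fun_prop)

theorem finiteDimensional_ker_add_comp (hC : IsUnit C) :
    FiniteDimensional ℂ (LinearMap.ker ((C + P ∘L Q : X →L[ℂ] X) : X →ₗ[ℂ] X)) := by
  refine FiniteDimensional.of_injective
    ((Q : X →ₗ[ℂ] (Fin n → ℂ)).comp (Submodule.subtype _)) ?_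
  refine (injective_iff_map_eq_zero _).2 fun x hx => ?_
  exact Subtype.ext (eq_zero_of_apply_eq_zero hC x.2 hx)

end Factor

open UnboundedOp

/-! ### Holomorphic dependence on the spectral parameter -/

section Holomorphic

variable {n : ℕ} {C J : X →L[ℂ] X} {P : (Fin n → ℂ) →L[ℂ] X} {Q : X →L[ℂ] (Fin n → ℂ)}

theorem differentiableAt_inverse_sub_smul {w : ℂ} (hw : IsUnit (C - w • J)) :
    DifferentiableAt ℂ (fun w : ℂ => Ring.inverse (C - w • J)) w := by
  have h : DifferentiableAt ℂ (fun w : ℂ => C - w • J) w := by fun_prop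
  exact (differentiableAt_inverse (𝕜 := ℂ) hw).comp w h

theorem differentiableAt_det_schurMatrix {w : ℂ} (hw : IsUnit (C - w • J)) :
    DifferentiableAt ℂ (fun w : ℂ => (schurMatrix (C - w • J) P Q).det) w := by
  have h := differentiableAt_inverse_sub_smul hw
  have hentry : ∀ i j, DifferentiableAt ℂ (fun w : ℂ => schurMatrix (C - w • J) P Q i j) w := by
    intro i j
    have heq : (fun w : ℂ => schurMatrix (C - w • J) P Q i j) = fun w : ℂ =>
        (1 : Matrix (Fin n) (Fin n) ℂ) i j +
          Q (Ring.inverse (C - w • J) (P (Pi.single j 1))) i := by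
      funext w
      rw [schurMatrix, Matrix.add_apply, LinearMap.toMatrix'_apply]
      rfl
    rw [heq]
    have h2 : DifferentiableAt ℂ
        (fun w : ℂ => Q (Ring.inverse (C - w • J) (P (Pi.single j 1)))) w :=
      Q.differentiableAt.comp w (h.clm_apply (differentiableAt_const _))
    exact (differentiableAt_const _).add (differentiableAt_pi.1 h2 i)
  simp_rw [Matrix.det_apply]
  refine DifferentiableAt.fun_sum fun σ _ => ?_
  exact (DifferentiableAt.fun_finsetProd fun i _ => hentry _ _).const_smul _

theorem continuousAt_schurMatrix (hC : IsUnit C) :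
    ContinuousAt (fun w : ℂ => schurMatrix (C - w • J) P Q) 0 := by
  have h := (differentiableAt_inverse_sub_smul (C := C) (J := J) (w := 0)
    (by simpa using hC)).continuousAt
  refine continuousAt_pi.2 fun i => continuousAt_pi.2 fun j => ?_
  have h2 : ContinuousAt (fun w : ℂ => Q (Ring.inverse (C - w • J) (P (Pi.single j 1))) i) 0 :=
    ((continuous_apply i).continuousAt).comp
      (Q.continuous.continuousAt.comp (h.clm_apply continuousAt_const))
  have heq : (fun w : ℂ => schurMatrix (C - w • J) P Q i j) = fun w : ℂ =>
      (1 : Matrix (Fin n) (Fin n) ℂ) i j +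
        Q (Ring.inverse (C - w • J) (P (Pi.single j 1))) i := by
    funext w
    rw [schurMatrix, Matrix.add_apply, LinearMap.toMatrix'_apply]
    rfl
  have h3 := (continuousAt_const (y := (1 : Matrix (Fin n) (Fin n) ℂ) i j)).add h2
  exact heq ▸ h3

theorem eventually_isUnit_sub_smul (hC : IsUnit C) (J : X →L[ℂ] X) :
    ∀ᶠ w : ℂ in 𝓝 0, IsUnit (C - w • J) := by
  have hopen : IsOpen {w : ℂ | IsUnit (C - w • J)} := Units.isOpen.preimage (by fun_prop)
  exact hopen.mem_nhds (by simpa using hC)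

theorem analyticAt_det_schurMatrix (hC : IsUnit C) :
    AnalyticAt ℂ (fun w : ℂ => (schurMatrix (C - w • J) P Q).det) 0 := by
  have hopen : IsOpen {w : ℂ | IsUnit (C - w • J)} := Units.isOpen.preimage (by fun_prop)
  have hd : DifferentiableOn ℂ (fun w : ℂ => (schurMatrix (C - w • J) P Q).det)
      {w : ℂ | IsUnit (C - w • J)} := fun w hw =>
    (differentiableAt_det_schurMatrix hw).differentiableWithinAt
  exact hd.analyticAt (hopen.mem_nhds (by simpa using hC))

/-- The sum telescopes: a Jordan chain of length $k$ gives a polynomial in $w$ that the perturbed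
operator sends to order $w^k$. -/
theorem pencil_sum_eq {A J : X →L[ℂ] X} {b : ℕ → X} {k : ℕ} (h0 : b 0 = 0)
    (hb : ∀ j < k, A (b (j + 1)) = J (b j)) (w : ℂ) :
    (A - w • J) (∑ j ∈ Finset.range k, w ^ j • b (j + 1)) = -(w ^ k • J (b k)) := by
  have : ∀ j ∈ Finset.range k, (A - w • J) (w ^ j • b (j + 1)) =
      w ^ j • J (b j) - w ^ (j + 1) • J (b (j + 1)) := fun j hj => by
    rw [map_smul, sub_apply, hb j (Finset.mem_range.1 hj), smul_sub, smul_apply, smul_smul, pow_succ]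
  rw [map_sum, Finset.sum_congr rfl this, Finset.sum_range_sub', h0]
  simp

/-- The length of a Jordan chain of `C + P Q` is bounded by the order of the zero of the
determinant. -/
theorem jordanChain_eq_zero (hC : IsUnit C) {m : ℕ} {g : ℂ → ℂ} (hg : ContinuousAt g 0)
    (hg0 : g 0 ≠ 0)
    (hd : ∀ᶠ w in 𝓝 0, (schurMatrix (C - w • J) P Q).det = w ^ m * g w)
    {b : ℕ → X} (h0 : b 0 = 0) (hb : ∀ j < m + 1, (C + P ∘L Q) (b (j + 1)) = J (b j)) :
    b 1 = 0 := by
  set ψ : ℂ → X := fun w => ∑ j ∈ Finset.range (m + 1), w ^ j • b (j + 1) with hψ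
  set y : ℂ → (Fin n → ℂ) := fun w => (schurMatrix (C - w • J) P Q).adjugate.mulVec
    (Q (Ring.inverse (C - w • J) (J (b (m + 1))))) with hy
  have hψ0 : ψ 0 = b 1 := by
    simp only [hψ, Finset.sum_range_succ']
    simp
  -- Multiplying the reduced equation by the adjugate replaces the matrix by its determinant $w^m
  -- g(w)$. The right side carries $w^{m+1}$, so one factor $w$ survives the cancellation.
  have key : ∀ᶠ w in 𝓝[≠] (0 : ℂ), g w • Q (ψ w) = -(w • y w) := by
    filter_upwards [nhdsWithin_le_nhds hd, nhdsWithin_le_nhds (eventually_isUnit_sub_smul hC J),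
      self_mem_nhdsWithin] with w hdw hCw hw
    have h1 : ((C - w • J) + P ∘L Q) (ψ w) = -(w ^ (m + 1) • J (b (m + 1))) := by
      rw [show (C - w • J) + P ∘L Q = (C + P ∘L Q) - w • J by abel]
      exact pencil_sum_eq h0 hb w
    have h2 := schurMatrix_mulVec_apply (P := P) (Q := Q) hCw (ψ w)
    rw [h1, map_neg, map_neg, map_smul, map_smul] at h2
    have h3 := congrArg (schurMatrix (C - w • J) P Q).adjugate.mulVec h2
    rw [Matrix.mulVec_mulVec, Matrix.adjugate_mul, Matrix.smul_mulVec, Matrix.one_mulVec,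
      Matrix.mulVec_neg, Matrix.mulVec_smul, hdw, mul_smul, pow_succ, mul_smul, ← smul_neg] at h3
    exact smul_right_injective _ (pow_ne_zero m hw) h3
  have hinv := (differentiableAt_inverse_sub_smul (C := C) (J := J) (w := 0)
    (by simpa using hC)).continuousAt
  have hyc : ContinuousAt y 0 := by
    have hA : ContinuousAt (fun w : ℂ => (schurMatrix (C - w • J) P Q).adjugate) 0 :=
      (Continuous.matrix_adjugate continuous_id).continuousAt.comp (continuousAt_schurMatrix hC)
    have hv : ContinuousAt (fun w : ℂ => Q (Ring.inverse (C - w • J) (J (b (m + 1))))) 0 :=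
      Q.continuous.continuousAt.comp (hinv.clm_apply continuousAt_const)
    have hmul : Continuous fun p : Matrix (Fin n) (Fin n) ℂ × (Fin n → ℂ) => p.1.mulVec p.2 :=
      continuous_fst.matrix_mulVec continuous_snd
    exact ContinuousAt.comp (x := (0 : ℂ)) (g := fun p : Matrix (Fin n) (Fin n) ℂ × (Fin n → ℂ) =>
      p.1.mulVec p.2) (f := fun w : ℂ => ((schurMatrix (C - w • J) P Q).adjugate,
        Q (Ring.inverse (C - w • J) (J (b (m + 1)))))) hmul.continuousAt (hA.prodMk hv)
  have hψc : Continuous ψ := by fun_prop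
  have l1 : Tendsto (fun w => g w • Q (ψ w)) (𝓝[≠] 0) (𝓝 (g 0 • Q (ψ 0))) :=
    (hg.smul (Q.continuous.comp hψc).continuousAt).tendsto.mono_left nhdsWithin_le_nhds
  have l2 : Tendsto (fun w => -(w • y w)) (𝓝[≠] 0) (𝓝 (-((0 : ℂ) • y 0))) :=
    (continuousAt_id.smul hyc).neg.tendsto.mono_left nhdsWithin_le_nhds
  -- At $w=0$ the surviving factor forces $Q b_1=0$. Since $b_0=0$, $b_1$ also lies in the kernel,
  -- where $Q$ is injective.
  have h4 := tendsto_nhds_unique (l1.congr' key) l2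
  rw [zero_smul, neg_zero, smul_eq_zero, or_iff_right hg0, hψ0] at h4
  refine eq_zero_of_apply_eq_zero (P := P) hC ?_ h4
  rw [hb 0 (Nat.succ_pos m), h0, map_zero]

end Holomorphic

/-! ### The operator associated with a form -/

/-- The operator `T` in `E` is associated with the form represented by `B` in the form domain `X`,
embedded in `E` by `ι`: `T ψ = η` if and only if `ψ = ι x` and `⟪y, B x⟫ = ⟪ι y, η⟫` for all `y`. -/
def IsAssociated (T : E →ₗ.[ℂ] E) (ι : X →L[ℂ] E) (B : X →L[ℂ] X) : Prop :=
  ∀ ψ η : E, (∃ h : ψ ∈ T.domain, T ⟨ψ, h⟩ = η) ↔ ∃ x, ι x = ψ ∧ B x = adjoint ι η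

/-- The operator `B - z ι* ι` that represents the form shifted by `z`. -/
def pencil (ι : X →L[ℂ] E) (B : X →L[ℂ] X) (z : ℂ) : X →L[ℂ] X :=
  B - z • (adjoint ι ∘L ι)

theorem pencil_apply (ι : X →L[ℂ] E) (B : X →L[ℂ] X) (z : ℂ) (x : X) :
    pencil ι B z x = B x - z • adjoint ι (ι x) := rfl

variable {T : E →ₗ.[ℂ] E} {ι : X →L[ℂ] E} {B : X →L[ℂ] X}

theorem shift_apply (z : ℂ) (x : T.domain) : shift T z x = T x - z • (x : E) := rfl

theorem IsAssociated.shift_iff (h : IsAssociated T ι B) (z : ℂ) (ψ η : E) :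
    (∃ hψ : ψ ∈ T.domain, shift T z ⟨ψ, hψ⟩ = η) ↔
      ∃ x, ι x = ψ ∧ pencil ι B z x = adjoint ι η := by
  have h1 := h ψ (η + z • ψ)
  constructor
  · rintro ⟨hψ, rfl⟩
    obtain ⟨x, hx, hBx⟩ := h1.1 ⟨hψ, by rw [shift_apply]; abel⟩
    refine ⟨x, hx, ?_⟩
    rw [pencil_apply, hBx, hx, map_add, map_smul]
    abel
  · rintro ⟨x, hx, hBx⟩
    obtain ⟨hψ, hT⟩ := h1.2 ⟨x, hx, by
      rw [pencil_apply, hx] at hBx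
      rw [map_add, map_smul, ← hBx]
      abel⟩
    refine ⟨hψ, ?_⟩
    rw [shift_apply, hT]
    abel

theorem IsAssociated.mem_resolventSet (h : IsAssociated T ι B) {z : ℂ}
    (hz : IsUnit (pencil ι B z)) : z ∈ resolventSet T := by
  refine ⟨ι ∘L Ring.inverse (pencil ι B z) ∘L adjoint ι, fun x => ?_, fun y => ?_⟩
  · obtain ⟨x', hx', hB⟩ := (h.shift_iff z x (shift T z x)).1 ⟨x.2, rfl⟩
    rw [comp_apply, comp_apply, ← hB, inverse_apply_self hz, hx']
  · exact (h.shift_iff z _ y).2 ⟨_, rfl, apply_inverse_self hz _⟩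

theorem IsAssociated.isEigenvalue (h : IsAssociated T ι B) (hι : Function.Injective ι) {z : ℂ}
    {x : X} (hx0 : x ≠ 0) (hx : pencil ι B z x = 0) : IsEigenvalue T z := by
  obtain ⟨hψ, hs⟩ := (h.shift_iff z (ι x) 0).2 ⟨x, rfl, by rw [hx, map_zero]⟩
  refine ⟨⟨ι x, hψ⟩, fun h0 => hx0 ?_, ?_⟩
  · exact (map_eq_zero_iff ι hι).1 (congrArg Subtype.val h0)
  · rw [shift_apply, sub_eq_zero] at hs
    exact hs

/-- The vector `pencil ι B z x` need not lie in the range of $\iota^*$, so the resolvent does not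
apply to it directly. Subtracting the solution $y$ of the same equation at $z_0$ leaves
$(z-z_0)\iota^*\iota y$, to which it does apply. Errors need then be controlled only in the norm of
$X$, after Riesz representation. -/
theorem IsAssociated.exists_norm_le (h : IsAssociated T ι B) {z z₀ : ℂ}
    (hz₀ : IsUnit (pencil ι B z₀)) (hz : z ∈ resolventSet T) :
    ∃ c : ℝ, ∀ x, ‖ι x‖ ≤ c * ‖pencil ι B z x‖ := by
  obtain ⟨R, hR, -⟩ := hz
  refine ⟨‖(1 + (z - z₀) • R) ∘L ι ∘L Ring.inverse (pencil ι B z₀)‖, fun x => ?_⟩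
  set y := Ring.inverse (pencil ι B z₀) (pencil ι B z x) with hy
  have hy' : pencil ι B z₀ y = pencil ι B z x := apply_inverse_self hz₀ _
  have h1 : pencil ι B z (x - y) = adjoint ι ((z - z₀) • ι y) := by
    rw [map_sub, ← hy', pencil_apply, pencil_apply, map_smul, sub_smul]
    abel
  obtain ⟨hψ, hs⟩ := (h.shift_iff z (ι (x - y)) ((z - z₀) • ι y)).2 ⟨x - y, rfl, h1⟩
  have h2 := hR ⟨ι (x - y), hψ⟩
  rw [hs, map_smul] at h2
  replace h2 : (z - z₀) • R (ι y) = ι x - ι y := h2.trans (map_sub ι x y)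
  have h3 : ι x = ((1 + (z - z₀) • R) ∘L ι ∘L Ring.inverse (pencil ι B z₀))
      (pencil ι B z x) := by
    change ι x = ι y + (z - z₀) • R (ι y)
    rw [h2]
    abel
  exact h3 ▸ le_opNorm _ _

theorem IsAssociated.isClosed_range_shift (h : IsAssociated T ι B) {z : ℂ}
    (hz : IsClosed (Set.range (pencil ι B z))) : IsClosed (Set.range (shift T z)) := by
  have : Set.range (shift T z) = adjoint ι ⁻¹' Set.range (pencil ι B z) := by
    ext η
    constructor
    · rintro ⟨x, hx⟩
      obtain ⟨x', -, hB⟩ := (h.shift_iff z x η).1 ⟨x.2, hx⟩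
      exact ⟨x', hB⟩
    · rintro ⟨x, hx⟩
      obtain ⟨hψ, hs⟩ := (h.shift_iff z (ι x) η).2 ⟨x, rfl, hx⟩
      exact ⟨_, hs⟩
  rw [this]
  exact hz.preimage (adjoint ι).continuous

/-! ### Root vectors as Jordan chains of the pencil -/

theorem mem_kerPow_succ {z : ℂ} {k : ℕ} {ψ : E} :
    ψ ∈ kerPow T z (k + 1) ↔ ∃ hψ : ψ ∈ T.domain, shift T z ⟨ψ, hψ⟩ ∈ kerPow T z k := by
  rw [kerPow, Submodule.mem_map]
  constructor
  · rintro ⟨x, hx, rfl⟩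
    exact ⟨x.2, hx⟩
  · rintro ⟨hψ, hs⟩
    exact ⟨⟨ψ, hψ⟩, hs, rfl⟩

theorem kerPow_le_succ (T : E →ₗ.[ℂ] E) (z : ℂ) (k : ℕ) : kerPow T z k ≤ kerPow T z (k + 1) := by
  induction k with
  | zero => exact bot_le
  | succ k ih =>
    intro ψ hψ
    obtain ⟨hd, hs⟩ := mem_kerPow_succ.1 hψ
    exact mem_kerPow_succ.2 ⟨hd, ih hs⟩

/-- Here $\iota(y_j)$ is $(T-z)^j\psi$ for $j\le k$: the chain is listed from its top vector down to
zero. -/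
theorem IsAssociated.mem_kerPow_iff (h : IsAssociated T ι B) {z : ℂ}
    {k : ℕ} {ψ : E} : ψ ∈ kerPow T z k ↔ ∃ y : ℕ → X, ι (y 0) = ψ ∧ y k = 0 ∧
      ∀ j < k, pencil ι B z (y j) = adjoint ι (ι (y (j + 1))) := by
  induction k generalizing ψ with
  | zero =>
    rw [kerPow, Submodule.mem_bot]
    constructor
    · rintro rfl
      exact ⟨0, by simp⟩
    · rintro ⟨y, rfl, hy, -⟩
      rw [hy, map_zero]
  | succ k ih =>
    rw [mem_kerPow_succ]
    constructor
    · rintro ⟨hψ, hs⟩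
      obtain ⟨y, hy0, hyk, hy⟩ := ih.1 hs
      obtain ⟨x, hx, hB⟩ := (h.shift_iff z ψ _).1 ⟨hψ, hy0.symm⟩
      refine ⟨fun j => Nat.casesOn j x y, hx, hyk, fun j hj => ?_⟩
      cases j with
      | zero => exact hB
      | succ j => exact hy j (by omega)
    · rintro ⟨y, rfl, hyk, hy⟩
      obtain ⟨hψ, hs⟩ := (h.shift_iff z (ι (y 0)) (ι (y 1))).2 ⟨y 0, rfl, hy 0 (by omega)⟩
      refine ⟨hψ, ?_⟩
      rw [hs]
      exact ih.2 ⟨fun j => y (j + 1), rfl, hyk, fun j hj => hy (j + 1) (by omega)⟩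

/-- Each step takes a preimage of a finite-dimensional space under $T-z$, whose kernel is
finite-dimensional because it embeds in the kernel of the pencil. -/
theorem IsAssociated.finiteDimensional_kerPow (h : IsAssociated T ι B) {z : ℂ}
    (hz : FiniteDimensional ℂ (LinearMap.ker (pencil ι B z : X →ₗ[ℂ] X))) (k : ℕ) :
    FiniteDimensional ℂ (kerPow T z k) := by
  have hker : FiniteDimensional ℂ (LinearMap.ker (shift T z)) := by
    have hle : (LinearMap.ker (shift T z)).map T.domain.subtype ≤
        (LinearMap.ker (pencil ι B z : X →ₗ[ℂ] X)).map (ι : X →ₗ[ℂ] E) := by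
      rintro _ ⟨x, hx, rfl⟩
      obtain ⟨x', hx', hB⟩ := (h.shift_iff z x 0).1 ⟨x.2, hx⟩
      exact ⟨x', by simpa using hB, hx'⟩
    have := Submodule.finiteDimensional_of_le hle
    exact LinearEquiv.finiteDimensional
      (Submodule.equivMapOfInjective T.domain.subtype T.domain.injective_subtype _).symm
  induction k with
  | zero =>
    rw [kerPow]
    infer_instance
  | succ k ih =>
    have : FiniteDimensional ℂ ((kerPow T z k).comap (shift T z)) := inferInstance
    rw [kerPow]
    infer_instance

theorem rootSpace_eq_kerPow {z : ℂ} {m : ℕ} (hm : kerPow T z (m + 1) ≤ kerPow T z m) :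
    rootSpace T z = kerPow T z m := by
  have hmono : Monotone (kerPow T z) := monotone_nat_of_le_succ (kerPow_le_succ T z)
  have hstable : ∀ k, kerPow T z (m + k) ≤ kerPow T z m := by
    intro k
    induction k with
    | zero => exact le_rfl
    | succ k ih =>
      intro ψ hψ
      obtain ⟨hd, hs⟩ := mem_kerPow_succ.1 hψ
      exact hm (mem_kerPow_succ.2 ⟨hd, ih hs⟩)
  refine le_antisymm (iSup_le fun k => ?_) (le_iSup (kerPow T z) m)
  exact (hmono (Nat.le_add_left k m)).trans (hstable k)

/-! ### Analytic Fredholm theory for the pencil -/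

/-- A point of the spectrum at which the shifted form operator is a finite rank perturbation of an
invertible one, and which is a limit of points of invertibility, belongs to the discrete spectrum. -/
theorem IsAssociated.mem_discreteSpectrum (h : IsAssociated T ι B) (hι : Function.Injective ι)
    {z : ℂ} {C F : X →L[ℂ] X} (hC : IsUnit C)
    (hF : F ∈ finiteRank X) (hCF : pencil ι B z = C + F) (hz : z ∈ spectrum T)
    (hne : ¬∀ᶠ w in 𝓝 z, ¬IsUnit (pencil ι B w)) : z ∈ discreteSpectrum T := by
  obtain ⟨n, P, Q, rfl⟩ := exists_factorization_of_mem_finiteRank hF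
  set J : X →L[ℂ] X := adjoint ι ∘L ι
  have hpencil : ∀ w : ℂ, pencil ι B (z + w) = (C - w • J) + P ∘L Q := fun w => by
    have : pencil ι B (z + w) = pencil ι B z - w • J := by
      unfold pencil
      rw [add_smul]
      abel
    rw [this, hCF]
    abel
  have hunit : ∀ᶠ w : ℂ in 𝓝 0,
      (IsUnit (pencil ι B (z + w)) ↔ (schurMatrix (C - w • J) P Q).det ≠ 0) := by
    filter_upwards [eventually_isUnit_sub_smul hC J] with w hw
    rw [hpencil, isUnit_iff_det_ne_zero hw]
  have htend : Tendsto (fun w : ℂ => w - z) (𝓝 z) (𝓝 0) := by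
    have : Tendsto (fun w : ℂ => w - z) (𝓝 z) (𝓝 (z - z)) := tendsto_id.sub_const z
    rwa [sub_self] at this
  have hzero : ¬∀ᶠ w : ℂ in 𝓝 0, (schurMatrix (C - w • J) P Q).det = 0 := fun hall => hne <| by
    filter_upwards [htend.eventually (hall.and hunit)] with w hw
    rw [add_sub_cancel] at hw
    rw [hw.2]
    exact not_not.2 hw.1
  -- The order $m$ of the zero serves twice: the factorization isolates $z$ in the spectrum, and $m$
  -- bounds the length of Jordan chains.
  obtain ⟨m, g, hg, hg0, hdet⟩ :=
    (analyticAt_det_schurMatrix hC).exists_eventuallyEq_pow_smul_nonzero_iff.2 hzero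
  simp only [sub_zero, smul_eq_mul] at hdet
  have hnotunit : ¬IsUnit (pencil ι B z) := fun hu => hz (h.mem_resolventSet hu)
  obtain ⟨x, hx0, hx⟩ : ∃ x, x ≠ 0 ∧ pencil ι B z x = 0 := by
    rw [hCF] at hnotunit ⊢
    rw [isUnit_iff_det_ne_zero hC, not_not] at hnotunit
    exact exists_ne_zero_of_det_eq_zero hC hnotunit
  have hker : FiniteDimensional ℂ (LinearMap.ker (pencil ι B z : X →ₗ[ℂ] X)) := by
    rw [hCF]
    exact finiteDimensional_ker_add_comp hC
  refine ⟨h.isEigenvalue hι hx0 hx, ?_, ?_, h.isClosed_range_shift ?_⟩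
  · have hpunct : ∀ᶠ w : ℂ in 𝓝 0, w ≠ 0 → IsUnit (pencil ι B (z + w)) := by
      filter_upwards [hunit, hdet, hg.continuousAt.eventually_ne hg0] with w h1 h2 h3 h4
      rw [h1, h2]
      exact mul_ne_zero (pow_ne_zero _ h4) h3
    obtain ⟨r, hr, hball⟩ := Metric.eventually_nhds_iff_ball.1 hpunct
    refine ⟨r, hr, Set.eq_singleton_iff_unique_mem.2 ⟨⟨hz, Metric.mem_ball_self hr⟩, ?_⟩⟩
    rintro w ⟨hw, hwr⟩
    by_contra hwz
    refine hw (h.mem_resolventSet ?_)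
    have := hball (w - z) (by simpa [dist_eq_norm] using hwr) (sub_ne_zero.2 hwz)
    rwa [add_sub_cancel] at this
  · have hstab : kerPow T z (m + 1) ≤ kerPow T z m := by
      intro ψ hψ
      obtain ⟨y, hy0, hyk, hy⟩ := (h.mem_kerPow_iff).1 hψ
      refine (h.mem_kerPow_iff).2 ⟨y, hy0, ?_, fun j hj => hy j (by omega)⟩
      -- The chain is reversed, so that $b_0=y_{m+1}=0$ and the conclusion $b_1=0$ reads $y_m=0$.
      refine jordanChain_eq_zero (P := P) (Q := Q) (J := J) hC hg.continuousAt hg0 hdet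
        (b := fun j => y (m + 1 - j)) hyk fun j hj => ?_
      rw [← hCF, hy _ (by omega), show m + 1 - (j + 1) + 1 = m + 1 - j by omega]
      rfl
    rw [rootSpace_eq_kerPow hstab]
    exact h.finiteDimensional_kerPow hker m
  · rw [hCF]
    exact isClosed_range_add_comp hC

/-- Invertibility of the shifted form operator propagates along connected sets on which it is a
finite rank perturbation of an invertible operator. -/
theorem not_eventually_not_isUnit_pencil {s : Set ℂ} (hs : IsPreconnected s)
    (hfred : ∀ z ∈ s, ∃ C F : X →L[ℂ] X, IsUnit C ∧ F ∈ finiteRank X ∧ pencil ι B z = C + F)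
    {z₀ : ℂ} (hz₀ : z₀ ∈ s) (hu₀ : IsUnit (pencil ι B z₀)) {z : ℂ} (hz : z ∈ s) :
    ¬∀ᶠ w in 𝓝 z, ¬IsUnit (pencil ι B w) := by
  -- Both sets are open and they are disjoint. The dichotomy for zeros of the analytic determinant
  -- shows that they cover $s$; connectedness leaves only $U$, which contains $z_0$.
  set U : Set ℂ := {z | ∀ᶠ w in 𝓝[≠] z, IsUnit (pencil ι B w)}
  set N : Set ℂ := {z | ∀ᶠ w in 𝓝 z, ¬IsUnit (pencil ι B w)}
  have hdisj : Disjoint U N := by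
    rw [Set.disjoint_left]
    intro w hU hN
    have hU' : ∀ᶠ v in 𝓝[≠] w, IsUnit (pencil ι B v) := hU
    have hN' : ∀ᶠ v in 𝓝[≠] w, ¬IsUnit (pencil ι B v) := nhdsWithin_le_nhds hN
    obtain ⟨v, hv⟩ := (hU'.and hN').exists
    exact hv.2 hv.1
  have hN : IsOpen N := isOpen_setOfPred_eventually_nhds
  have hU : IsOpen U := by
    have := isOpen_setOfPred_eventually_nhdsWithin (p := fun w => IsUnit (pencil ι B w))
    exact this
  have hcover : s ⊆ U ∪ N := by
    intro w hw
    obtain ⟨C, F, hC, hF, hCF⟩ := hfred w hw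
    obtain ⟨n, P, Q, rfl⟩ := exists_factorization_of_mem_finiteRank hF
    set J : X →L[ℂ] X := adjoint ι ∘L ι
    have hunit : ∀ᶠ v : ℂ in 𝓝 0,
        (IsUnit (pencil ι B (w + v)) ↔ (schurMatrix (C - v • J) P Q).det ≠ 0) := by
      filter_upwards [eventually_isUnit_sub_smul hC J] with v hv
      have : pencil ι B (w + v) = (C - v • J) + P ∘L Q := by
        have h1 : pencil ι B (w + v) = pencil ι B w - v • J := by
          unfold pencil
          rw [add_smul]
          abel
        rw [h1, hCF]
        abel
      rw [this, isUnit_iff_det_ne_zero hv]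
    have htend : Tendsto (fun v : ℂ => v - w) (𝓝 w) (𝓝 0) := by
      have : Tendsto (fun v : ℂ => v - w) (𝓝 w) (𝓝 (w - w)) := tendsto_id.sub_const w
      rwa [sub_self] at this
    have htend' : Tendsto (fun v : ℂ => v - w) (𝓝[≠] w) (𝓝[≠] 0) := by
      refine tendsto_nhdsWithin_iff.2 ⟨htend.mono_left nhdsWithin_le_nhds, ?_⟩
      filter_upwards [self_mem_nhdsWithin] with v hv
      exact sub_ne_zero.2 hv
    rcases (analyticAt_det_schurMatrix (P := P) (Q := Q) (J := J)
      hC).eventually_eq_zero_or_eventually_ne_zero with h0 | h0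
    · right
      change ∀ᶠ v in 𝓝 w, ¬IsUnit (pencil ι B v)
      filter_upwards [htend.eventually (h0.and hunit)] with v hv
      rw [add_sub_cancel] at hv
      rw [hv.2]
      exact not_not.2 hv.1
    · left
      change ∀ᶠ v in 𝓝[≠] w, IsUnit (pencil ι B v)
      filter_upwards [htend'.eventually (h0.and (nhdsWithin_le_nhds hunit))] with v hv
      rw [add_sub_cancel] at hv
      exact hv.2.2 hv.1
  have hopen : IsOpen {w : ℂ | IsUnit (pencil ι B w)} := by
    unfold pencil
    exact Units.isOpen.preimage (by fun_prop)
  have hz₀U : z₀ ∈ U := nhdsWithin_le_nhds (hopen.mem_nhds hu₀)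
  have hsub := hs.subset_left_of_subset_union hU hN hdisj hcover ⟨z₀, hz₀, hz₀U⟩
  exact Set.disjoint_left.1 hdisj (hsub hz)

end FormPencil

namespace StepSchrodinger

open Filter Topology

/-! ### Weak derivatives tested against Schwartz functions -/

/-- The complex conjugate of a Schwartz function. -/
def conjSchwartz (f : 𝓢(ℝ, ℂ)) : 𝓢(ℝ, ℂ) :=
  SchwartzMap.postcompCLM (𝕜 := ℝ) (conjCLE : ℂ →L[ℝ] ℂ) f

@[simp]
theorem conjSchwartz_apply (f : 𝓢(ℝ, ℂ)) (x : ℝ) : conjSchwartz f x = starRingEnd ℂ (f x) := rfl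

theorem lineDeriv_one_apply (f : 𝓢(ℝ, ℂ)) (x : ℝ) : (∂_{(1 : ℝ)} f) x = deriv f x := by
  rw [SchwartzMap.lineDerivOp_apply_eq_fderiv]
  exact fderiv_apply_one_eq_deriv

theorem lineDeriv_conjSchwartz (f : 𝓢(ℝ, ℂ)) :
    ∂_{(1 : ℝ)} (conjSchwartz f) = conjSchwartz (∂_{(1 : ℝ)} f) := by
  ext x
  rw [lineDeriv_one_apply, conjSchwartz_apply, lineDeriv_one_apply]
  have h : HasDerivAt (conjSchwartz f) ((conjCLE : ℂ →L[ℝ] ℂ) (deriv f x)) x :=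
    ((conjCLE : ℂ →L[ℝ] ℂ).hasFDerivAt (x := f x)).comp_hasDerivAt x (f.hasDerivAt x)
  exact h.deriv

theorem inner_toLp (f : 𝓢(ℝ, ℂ)) (u : L2) :
    inner ℂ (f.toLp 2) u = ∫ x, starRingEnd ℂ (f x) * u x := by
  rw [L2.inner_def]
  refine integral_congr_ae ?_
  filter_upwards [f.coeFn_toLp 2] with x hx
  rw [hx, RCLike.inner_apply, mul_comm]

theorem toTemperedDistribution_apply_eq_inner (u : L2) (f : 𝓢(ℝ, ℂ)) :
    (u : 𝓢'(ℝ, ℂ)) f = inner ℂ ((conjSchwartz f).toLp 2) u := by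
  rw [Lp.toTemperedDistribution_apply, inner_toLp]
  simp

/-- In terms of inner products the condition is a family of closed equations, and it can be read off
from orthogonality to Schwartz functions. Conjugating the test function accounts for the antilinear
slot. -/
theorem isWeakDeriv_iff {u v : L2} :
    IsWeakDeriv u v ↔ ∀ f : 𝓢(ℝ, ℂ),
      inner ℂ ((∂_{(1 : ℝ)} f).toLp 2) u = -inner ℂ (f.toLp 2) v := by
  have key : ∀ f : 𝓢(ℝ, ℂ), (∂_{(1 : ℝ)} (u : 𝓢'(ℝ, ℂ))) f =
      -inner ℂ ((∂_{(1 : ℝ)} (conjSchwartz f)).toLp 2) u := fun f => by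
    rw [TemperedDistribution.lineDerivOp_apply_apply, map_neg,
      toTemperedDistribution_apply_eq_inner, lineDeriv_conjSchwartz]
  have hconj : ∀ f, conjSchwartz (conjSchwartz f) = f := fun f => by ext x; simp
  constructor
  · intro h f
    have h1 := key (conjSchwartz f)
    rw [hconj, show ∂_{(1 : ℝ)} (u : 𝓢'(ℝ, ℂ)) = (v : 𝓢'(ℝ, ℂ)) from h,
      toTemperedDistribution_apply_eq_inner, hconj] at h1
    rw [h1, neg_neg]
  · intro h
    refine ContinuousLinearMap.ext fun f => ?_
    refine (key f).trans ?_
    rw [h, neg_neg]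
    exact (toTemperedDistribution_apply_eq_inner v f).symm

theorem isWeakDeriv_toLp (f : 𝓢(ℝ, ℂ)) :
    IsWeakDeriv (f.toLp 2 volume) ((∂_{(1 : ℝ)} f).toLp 2 volume) := by
  unfold IsWeakDeriv
  rw [Lp.toTemperedDistribution_toLp_eq, Lp.toTemperedDistribution_toLp_eq,
    lineDerivOp_toTemperedDistributionCLM_eq]

/-- An `L²` function that equals its second distributional derivative vanishes. -/
theorem eq_zero_of_isWeakDeriv_isWeakDeriv {u v : L2} (h : IsWeakDeriv u v)
    (h' : IsWeakDeriv v u) : u = 0 := by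
  set U : 𝓢'(ℝ, ℂ) := (u : 𝓢'(ℝ, ℂ)) with hU
  have h1 : ∂_{(1 : ℝ)} (∂_{(1 : ℝ)} U) = U := by
    rw [show ∂_{(1 : ℝ)} U = (v : 𝓢'(ℝ, ℂ)) from h]
    exact h'
  set a : ℝ → ℂ := fun x => ((inner ℝ x (1 : ℝ) : ℝ) : ℂ) with ha
  have ha1 : a.HasTemperateGrowth := by fun_prop
  -- This is the inverse of the symbol $1+4\pi^2x^2$ of $1-\partial^2$; composing the two
  -- multipliers recovers $U$ from $(1-\partial^2)U=0$.
  set b : ℝ → ℂ := fun x => (((1 + ‖2 * Real.pi * x‖ ^ 2) ^ (-1 : ℝ) : ℝ) : ℂ) with hb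
  have hb1 : b.HasTemperateGrowth := by
    have h2 : (fun x : ℝ => 2 * Real.pi * x).HasTemperateGrowth := by fun_prop
    have h3 : (fun x : ℝ => (1 + ‖x‖ ^ 2) ^ (-1 : ℝ)).HasTemperateGrowth := by fun_prop
    have h4 : (fun x : ℝ => (1 + ‖2 * Real.pi * x‖ ^ 2) ^ (-1 : ℝ)).HasTemperateGrowth := h3.comp h2
    fun_prop
  rw [lineDeriv_eq_fourierMultiplierCLM, lineDeriv_eq_fourierMultiplierCLM, map_smul, smul_smul,
    fourierMultiplierCLM_fourierMultiplierCLM_apply ha1 ha1] at h1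
  have h2 : fourierMultiplierCLM ℂ ((1 + (4 * Real.pi ^ 2 : ℂ) • (a * a)) * b) U = 0 := by
    have haa : (a * a).HasTemperateGrowth := ha1.mul ha1
    have hc : ((4 * Real.pi ^ 2 : ℂ) • (a * a)).HasTemperateGrowth := by
      have : ((fun _ : ℝ => (4 * Real.pi ^ 2 : ℂ)) * (a * a)).HasTemperateGrowth :=
        (Function.HasTemperateGrowth.const _).mul haa
      exact this
    have h1c : (1 : ℝ → ℂ).HasTemperateGrowth := Function.HasTemperateGrowth.const 1
    rw [← fourierMultiplierCLM_fourierMultiplierCLM_apply (h1c.add hc) hb1]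
    have h4 : fourierMultiplierCLM ℂ (1 + (4 * Real.pi ^ 2 : ℂ) • (a * a)) U = 0 := by
      have h5 : fourierMultiplierCLM ℂ (1 + (4 * Real.pi ^ 2 : ℂ) • (a * a)) U =
          fourierMultiplierCLM ℂ (fun _ : ℝ => (1 : ℂ)) U +
            (4 * Real.pi ^ 2 : ℂ) • fourierMultiplierCLM ℂ (a * a) U := by
        simp only [fourierMultiplierCLM_apply]
        rw [← FourierTransform.fourierInv_smul, ← FourierTransform.fourierInv_add,
          smulLeftCLM_add h1c hc, smulLeftCLM_smul haa]
        rfl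
      rw [h5, fourierMultiplierCLM_const]
      nth_rewrite 1 [← h1]
      simp only [one_smul, ContinuousLinearMap.id_apply]
      rw [← add_smul]
      convert zero_smul ℂ _ using 2
      ring_nf
      simp
    rw [h4, map_zero]
  have h3 : (1 + (4 * Real.pi ^ 2 : ℂ) • (a * a)) * b = fun _ => 1 := by
    funext x
    have hx : (0 : ℝ) < 1 + ‖2 * Real.pi * x‖ ^ 2 := by positivity
    simp only [ha, hb, Pi.mul_apply, Pi.add_apply, Pi.one_apply, Pi.smul_apply, smul_eq_mul,
      Real.rpow_neg_one]
    have h4 : (1 : ℂ) + 4 * Real.pi ^ 2 * (((inner ℝ x (1 : ℝ) : ℝ) : ℂ) * ((inner ℝ x (1 : ℝ) : ℝ) : ℂ))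
        = ((1 + ‖2 * Real.pi * x‖ ^ 2 : ℝ) : ℂ) := by
      simp only [Real.norm_eq_abs, sq_abs]
      push_cast
      simp
      ring
    rw [h4, ← Complex.ofReal_mul, mul_inv_cancel₀ hx.ne', Complex.ofReal_one]
  rw [h3, fourierMultiplierCLM_const, one_smul] at h2
  have h4 := LinearMap.ker_eq_bot.mp
    (Lp.ker_toTemperedDistributionCLM_eq_bot (F := ℂ) (μ := (volume : Measure ℝ)) (p := 2))
  refine h4 ?_
  rw [map_zero]
  exact h2

/-! ### The Sobolev space `W^{1,2}(ℝ)` as a Hilbert space -/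

/-- The graph of the weak derivative. -/
def sobolevGraph : Submodule ℂ (WithLp 2 (L2 × L2)) where
  carrier := {p | IsWeakDeriv p.fst p.snd}
  zero_mem' := isWeakDeriv_iff.2 fun f => by simp
  add_mem' hp hq := hp.add hq
  smul_mem' c _ hp := hp.smul c

/-- The Hilbert space `W^{1,2}(ℝ)` with the norm `(‖u‖² + ‖u'‖²)^{1/2}`. -/
def H1 : Type := sobolevGraph

instance : NormedAddCommGroup H1 := inferInstanceAs (NormedAddCommGroup sobolevGraph)

instance : InnerProductSpace ℂ H1 := inferInstanceAs (InnerProductSpace ℂ sobolevGraph)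

instance : CompleteSpace H1 := by
  change CompleteSpace sobolevGraph
  suffices h : IsClosed (sobolevGraph : Set (WithLp 2 (L2 × L2))) from h.completeSpace_coe
  have : (sobolevGraph : Set (WithLp 2 (L2 × L2))) = ⋂ f : 𝓢(ℝ, ℂ),
      {p | inner ℂ ((∂_{(1 : ℝ)} f).toLp 2) p.fst = -inner ℂ (f.toLp 2) p.snd} := by
    ext p
    simp only [Set.mem_iInter]
    exact isWeakDeriv_iff
  rw [this]
  refine isClosed_iInter fun f => isClosed_eq ?_ ?_
  · exact continuous_const.inner (WithLp.fstL 2 ℂ L2 L2).continuous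
  · exact (continuous_const.inner (WithLp.sndL 2 ℂ L2 L2).continuous).neg

namespace H1

/-- The embedding of `W^{1,2}(ℝ)` in `L²(ℝ)`. -/
def incl : H1 →L[ℂ] L2 :=
  show sobolevGraph →L[ℂ] L2 from (WithLp.fstL 2 ℂ L2 L2) ∘L sobolevGraph.subtypeL

/-- The derivative on `W^{1,2}(ℝ)`. -/
def der : H1 →L[ℂ] L2 :=
  show sobolevGraph →L[ℂ] L2 from (WithLp.sndL 2 ℂ L2 L2) ∘L sobolevGraph.subtypeL

/-- The element of `W^{1,2}(ℝ)` given by a function and its weak derivative. -/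
def mk (u v : L2) (h : IsWeakDeriv u v) : H1 := ⟨WithLp.toLp 2 (u, v), h⟩

@[simp]
theorem incl_mk (u v : L2) (h : IsWeakDeriv u v) : incl (mk u v h) = u := rfl

@[simp]
theorem der_mk (u v : L2) (h : IsWeakDeriv u v) : der (mk u v h) = v := rfl

theorem isWeakDeriv (p : H1) : IsWeakDeriv (incl p) (der p) := p.2

theorem incl_injective : Function.Injective incl := by
  intro p q h
  refine Subtype.ext (WithLp.ofLp_injective 2 (Prod.ext h ?_))
  have h1 := isWeakDeriv p
  rw [h] at h1
  exact h1.unique (isWeakDeriv q)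

theorem inner_eq (p q : H1) :
    inner ℂ p q = inner ℂ (incl p) (incl q) + inner ℂ (der p) (der q) := rfl

theorem norm_sq_eq (p : H1) : ‖p‖ ^ 2 = ‖incl p‖ ^ 2 + ‖der p‖ ^ 2 := by
  have h := congrArg Complex.re (inner_eq p p)
  rw [add_re] at h
  have h1 : ∀ {G : Type} [NormedAddCommGroup G] [InnerProductSpace ℂ G] (x : G),
      (inner ℂ x x).re = ‖x‖ ^ 2 := fun x => inner_self_eq_norm_sq (𝕜 := ℂ) x
  rwa [h1, h1, h1] at h

theorem norm_incl_le (p : H1) : ‖incl p‖ ≤ ‖p‖ :=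
  le_of_sq_le_sq (by rw [norm_sq_eq]; nlinarith [sq_nonneg ‖der p‖]) (norm_nonneg _)

theorem norm_der_le (p : H1) : ‖der p‖ ≤ ‖p‖ :=
  le_of_sq_le_sq (by rw [norm_sq_eq]; nlinarith [sq_nonneg ‖incl p‖]) (norm_nonneg _)

/-- Schwartz functions as elements of `W^{1,2}(ℝ)`. -/
def ofSchwartz : 𝓢(ℝ, ℂ) →ₗ[ℂ] H1 :=
  show 𝓢(ℝ, ℂ) →ₗ[ℂ] sobolevGraph from ((WithLp.linearEquiv 2 ℂ (L2 × L2)).symm.toLinearMap ∘ₗ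
    LinearMap.prod (SchwartzMap.toLpCLM ℂ ℂ 2 (volume : Measure ℝ)).toLinearMap
      ((SchwartzMap.toLpCLM ℂ ℂ 2 (volume : Measure ℝ)).toLinearMap ∘ₗ
        (LineDeriv.lineDerivOpCLM ℂ 𝓢(ℝ, ℂ) (1 : ℝ)).toLinearMap)).codRestrict sobolevGraph
    isWeakDeriv_toLp

@[simp]
theorem incl_ofSchwartz (f : 𝓢(ℝ, ℂ)) : incl (ofSchwartz f) = f.toLp 2 := rfl

@[simp]
theorem der_ofSchwartz (f : 𝓢(ℝ, ℂ)) : der (ofSchwartz f) = (∂_{(1 : ℝ)} f).toLp 2 := rfl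

/-- Orthogonality of $p$ to all Schwartz functions in the Sobolev inner product says $p''=p$ weakly,
and this has no nonzero $L^2$ solution. -/
theorem denseRange_ofSchwartz : DenseRange ofSchwartz := by
  have h : (LinearMap.range ofSchwartz).topologicalClosure = ⊤ := by
    rw [Submodule.topologicalClosure_eq_top_iff, Submodule.eq_bot_iff]
    intro p hp
    have h1 : IsWeakDeriv (der p) (incl p) := isWeakDeriv_iff.2 fun f => by
      have := (Submodule.mem_orthogonal _ _).1 hp (ofSchwartz f) ⟨f, rfl⟩
      rw [inner_eq, incl_ofSchwartz, der_ofSchwartz, add_comm] at this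
      exact eq_neg_of_add_eq_zero_left this
    refine incl_injective ?_
    rw [map_zero]
    exact eq_zero_of_isWeakDeriv_isWeakDeriv (isWeakDeriv p) h1
  intro x
  have : x ∈ (LinearMap.range ofSchwartz).topologicalClosure := h ▸ Submodule.mem_top
  exact this

/-- Integration by parts in `W^{1,2}(ℝ)`. -/
theorem inner_der_eq (p : H1) {v w : L2} (h : IsWeakDeriv v w) :
    inner ℂ (der p) v = -inner ℂ (incl p) w := by
  refine denseRange_ofSchwartz.induction_on (p := fun p => inner ℂ (der p) v =
    -inner ℂ (incl p) w) p (isClosed_eq (by fun_prop) (by fun_prop)) fun f => ?_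
  exact isWeakDeriv_iff.1 h f

end H1

end StepSchrodinger

namespace StepSchrodinger

open Filter Topology

/-! ### Point evaluation on `W^{1,2}(ℝ)` -/

/-- The increment is the inner product of the indicator of $(x,y]$ with $f'$; apply Cauchy–Schwarz.
-/
theorem norm_sub_le_sqrt_mul (f : 𝓢(ℝ, ℂ)) {x y : ℝ} (hxy : x ≤ y) :
    ‖f y - f x‖ ≤ √(y - x) * ‖(∂_{(1 : ℝ)} f).toLp 2 volume‖ := by
  have hcont : Continuous (deriv f) := by
    have : deriv f = ∂_{(1 : ℝ)} f := funext fun t => (lineDeriv_one_apply f t).symm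
    rw [this]
    exact SchwartzMap.continuous _
  have hfin : volume (Set.Ioc x y) ≠ ∞ := by simp
  have h1 : f y - f x = inner ℂ (indicatorConstLp 2 measurableSet_Ioc hfin (1 : ℂ))
      ((∂_{(1 : ℝ)} f).toLp 2 volume) := by
    rw [L2.inner_indicatorConstLp_one, ← intervalIntegral.integral_eq_sub_of_hasDerivAt
      (fun t _ => f.hasDerivAt t) (hcont.intervalIntegrable _ _),
      intervalIntegral.integral_of_le hxy]
    refine integral_congr_ae (ae_restrict_of_ae ?_)
    filter_upwards [(∂_{(1 : ℝ)} f).coeFn_toLp 2 volume] with t ht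
    rw [ht, lineDeriv_one_apply]
  rw [h1]
  refine (norm_inner_le_norm _ _).trans_eq ?_
  rw [norm_indicatorConstLp (by norm_num) (by norm_num), Real.volume_real_Ioc_of_le hxy, norm_one,
    one_mul, Real.sqrt_eq_rpow]
  norm_num

theorem norm_sub_le_sqrt_abs_mul (f : 𝓢(ℝ, ℂ)) (x y : ℝ) :
    ‖f y - f x‖ ≤ √|y - x| * ‖(∂_{(1 : ℝ)} f).toLp 2 volume‖ := by
  rcases le_total x y with h | h
  · rw [abs_of_nonneg (sub_nonneg.2 h)]
    exact norm_sub_le_sqrt_mul f h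
  · rw [abs_sub_comm, abs_of_nonneg (sub_nonneg.2 h), norm_sub_rev]
    exact norm_sub_le_sqrt_mul f h

theorem norm_sq_eq_integral (u : L2) : ‖u‖ ^ 2 = ∫ x, ‖u x‖ ^ 2 := by
  have h : (inner ℂ u u).re = ‖u‖ ^ 2 := inner_self_eq_norm_sq (𝕜 := ℂ) u
  rw [← h, L2.inner_def]
  have h2 : ∀ x, inner ℂ (u x) (u x) = ((‖u x‖ ^ 2 : ℝ) : ℂ) := fun x => by
    rw [inner_self_eq_norm_sq_to_K]
    push_cast
    rfl
  simp_rw [h2]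
  exact (congrArg Complex.re integral_ofReal).trans (Complex.ofReal_re _)

theorem integrable_norm_sq (u : L2) : Integrable fun x => ‖u x‖ ^ 2 :=
  (memLp_two_iff_integrable_sq_norm (Lp.aestronglyMeasurable u)).1 (Lp.memLp u)

/-- Average $|f(x)|^2\le 2|f(y)|^2+2h\|f'\|^2$ over $y\in(x,x+h]$. The free length $h$ allows an
arbitrarily small weight on the derivative, which makes a potential form-bounded with small relative
bound. -/
theorem norm_sq_le_of_schwartz (f : 𝓢(ℝ, ℂ)) (x : ℝ) {h : ℝ} (hh : 0 < h) :
    ‖f x‖ ^ 2 ≤ 2 / h * ‖f.toLp 2 volume‖ ^ 2 +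
      2 * h * ‖(∂_{(1 : ℝ)} f).toLp 2 volume‖ ^ 2 := by
  set N := ‖(∂_{(1 : ℝ)} f).toLp 2 volume‖ with hN
  have h1 : ∀ y ∈ Set.Ioc x (x + h), ‖f x‖ ^ 2 - 2 * h * N ^ 2 ≤ 2 * ‖f y‖ ^ 2 := by
    intro y hy
    have h2 := norm_sub_le_sqrt_mul f hy.1.le
    have h3 : √(y - x) * N ≤ √h * N :=
      mul_le_mul_of_nonneg_right (Real.sqrt_le_sqrt (by linarith [hy.2])) (norm_nonneg _)
    have h4 : ‖f x‖ ≤ ‖f y‖ + √h * N := by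
      have := norm_le_norm_add_norm_sub' (f x) (f y)
      rw [norm_sub_rev] at this
      linarith
    have h5 : ‖f x‖ ^ 2 ≤ (‖f y‖ + √h * N) ^ 2 := pow_le_pow_left₀ (norm_nonneg _) h4 2
    have h6 : (√h * N) ^ 2 = h * N ^ 2 := by rw [mul_pow, Real.sq_sqrt hh.le]
    nlinarith [sq_nonneg (‖f y‖ - √h * N)]
  have hint : Integrable fun y => ‖f y‖ ^ 2 := by
    have := (memLp_two_iff_integrable_sq_norm f.continuous.aestronglyMeasurable).1
      (f.memLp 2 volume)
    exact this
  have h7 : ∫ y in Set.Ioc x (x + h), (‖f x‖ ^ 2 - 2 * h * N ^ 2) ≤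
      ∫ y in Set.Ioc x (x + h), 2 * ‖f y‖ ^ 2 :=
    setIntegral_mono_on (by simp) (hint.const_mul 2).integrableOn measurableSet_Ioc h1
  have h8 : ∫ y in Set.Ioc x (x + h), 2 * ‖f y‖ ^ 2 ≤ ∫ y, 2 * ‖f y‖ ^ 2 :=
    setIntegral_le_integral (hint.const_mul 2) (Eventually.of_forall fun y => by positivity)
  have h9 : ∫ y, ‖f y‖ ^ 2 = ‖f.toLp 2 volume‖ ^ 2 := by
    rw [norm_sq_eq_integral]
    refine integral_congr_ae ?_
    filter_upwards [f.coeFn_toLp 2 volume] with y hy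
    rw [hy]
  rw [setIntegral_const, Real.volume_real_Ioc_of_le (by linarith), add_sub_cancel_left,
    smul_eq_mul] at h7
  have h11 : ∫ y, 2 * ‖f y‖ ^ 2 = 2 * ‖f.toLp 2 volume‖ ^ 2 := by rw [integral_const_mul, h9]
  rw [h11] at h8
  have h10 : h * (‖f x‖ ^ 2 - 2 * h * N ^ 2) ≤ h * (2 / h * ‖f.toLp 2 volume‖ ^ 2) := by
    rw [← mul_assoc, mul_div_cancel₀ _ hh.ne']
    exact h7.trans h8
  linarith [le_of_mul_le_mul_left h10 hh]

namespace H1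

/-- Evaluation of Schwartz functions at `x`. -/
def schwartzEval (x : ℝ) : 𝓢(ℝ, ℂ) →ₗ[ℂ] ℂ where
  toFun f := f x
  map_add' _ _ := rfl
  map_smul' _ _ := rfl

theorem norm_schwartzEval_le (x : ℝ) (f : 𝓢(ℝ, ℂ)) : ‖schwartzEval x f‖ ≤ 2 * ‖ofSchwartz f‖ := by
  have h := norm_sq_le_of_schwartz f x one_pos
  have h2 := norm_sq_eq (ofSchwartz f)
  rw [incl_ofSchwartz, der_ofSchwartz] at h2
  refine le_of_sq_le_sq (a := ‖schwartzEval x f‖) ?_ (by positivity)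
  change ‖f x‖ ^ 2 ≤ _
  nlinarith [sq_nonneg ‖ofSchwartz f‖]

/-- The value at `x` of the continuous representative of an element of `W^{1,2}(ℝ)`. -/
def eval (x : ℝ) : H1 →L[ℂ] ℂ := (schwartzEval x).extendOfNorm ofSchwartz

@[simp]
theorem eval_ofSchwartz (x : ℝ) (f : 𝓢(ℝ, ℂ)) : eval x (ofSchwartz f) = f x :=
  LinearMap.extendOfNorm_eq denseRange_ofSchwartz ⟨2, norm_schwartzEval_le x⟩ f

theorem norm_eval_apply_le (x : ℝ) (p : H1) : ‖eval x p‖ ≤ 2 * ‖p‖ :=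
  LinearMap.norm_extendOfNorm_apply_le denseRange_ofSchwartz 2 (norm_schwartzEval_le x) p

theorem norm_eval_le (x : ℝ) : ‖eval x‖ ≤ 2 :=
  ContinuousLinearMap.opNorm_le_bound _ zero_le_two (norm_eval_apply_le x)

theorem norm_eval_sq_le (x : ℝ) {h : ℝ} (hh : 0 < h) (p : H1) :
    ‖eval x p‖ ^ 2 ≤ 2 / h * ‖incl p‖ ^ 2 + 2 * h * ‖der p‖ ^ 2 := by
  refine denseRange_ofSchwartz.induction_on (p := fun p => ‖eval x p‖ ^ 2 ≤
    2 / h * ‖incl p‖ ^ 2 + 2 * h * ‖der p‖ ^ 2) p (isClosed_le (by fun_prop) (by fun_prop))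
    fun f => ?_
  rw [eval_ofSchwartz]
  exact norm_sq_le_of_schwartz f x hh

theorem norm_eval_sub_eval_le (x y : ℝ) : ‖eval y - eval x‖ ≤ √|y - x| := by
  refine ContinuousLinearMap.opNorm_le_bound _ (Real.sqrt_nonneg _) fun p => ?_
  refine denseRange_ofSchwartz.induction_on (p := fun p => ‖(eval y - eval x) p‖ ≤
    √|y - x| * ‖p‖) p (isClosed_le (by fun_prop) (by fun_prop)) fun f => ?_
  rw [sub_apply, eval_ofSchwartz, eval_ofSchwartz]
  refine (norm_sub_le_sqrt_abs_mul f x y).trans ?_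
  exact mul_le_mul_of_nonneg_left (norm_der_le (ofSchwartz f)) (Real.sqrt_nonneg _)

theorem continuous_eval : Continuous eval := by
  refine continuous_iff_continuousAt.2 fun x => ?_
  rw [ContinuousAt, tendsto_iff_norm_sub_tendsto_zero]
  refine squeeze_zero (fun _ => norm_nonneg _) (fun y => norm_eval_sub_eval_le x y) ?_
  have : Continuous fun y : ℝ => √|y - x| := by fun_prop
  have h := this.tendsto x
  simpa using h

/-- Along Schwartz approximations, the values converge everywhere to `eval`, while a subsequence
converges almost everywhere to the $L^2$ function. -/
theorem ae_eq_eval (p : H1) : ∀ᵐ x, incl p x = eval x p := by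
  obtain ⟨q, hq, hqp⟩ := mem_closure_iff_seq_limit.1 (denseRange_ofSchwartz p)
  choose f hf using hq
  have h1 : Tendsto (fun n => (f n).toLp 2 volume) atTop (𝓝 (incl p)) := by
    have := (incl.continuous.tendsto p).comp hqp
    refine this.congr fun n => ?_
    rw [Function.comp_apply, ← hf, incl_ofSchwartz]
  obtain ⟨ns, hns, hae⟩ := (tendstoInMeasure_of_tendsto_Lp h1).exists_seq_tendsto_ae
  have h2 : ∀ᵐ x, ∀ n, ((f n).toLp 2 volume : L2) x = f n x :=
    ae_all_iff.2 fun n => (f n).coeFn_toLp 2 volume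
  filter_upwards [hae, h2] with x hx hx2
  refine tendsto_nhds_unique hx ?_
  have h3 := (((eval x).continuous.tendsto p).comp hqp).comp hns.tendsto_atTop
  refine h3.congr fun n => ?_
  rw [Function.comp_apply, Function.comp_apply, ← hf, eval_ofSchwartz, hx2]

/-! ### Integrable potentials as operators on the form domain -/

/-- The Riesz representative of the evaluation at `x`. -/
def kernel (x : ℝ) : H1 := (InnerProductSpace.toDual ℂ H1).symm (eval x)

theorem inner_kernel (x : ℝ) (p : H1) : inner ℂ (kernel x) p = eval x p :=
  InnerProductSpace.toDual_symm_apply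

theorem continuous_kernel : Continuous kernel :=
  (InnerProductSpace.toDual ℂ H1).symm.continuous.comp continuous_eval

theorem norm_kernel_le (x : ℝ) : ‖kernel x‖ ≤ 2 := by
  rw [kernel, LinearIsometryEquiv.norm_map]
  exact norm_eval_le x

/-- The form `p, q ↦ p(x) conj q(x)` as an operator. -/
def pointForm (x : ℝ) : H1 →L[ℂ] H1 := (eval x).smulRight (kernel x)

theorem pointForm_apply (x : ℝ) (p : H1) : pointForm x p = eval x p • kernel x := rfl

theorem continuous_pointForm : Continuous pointForm := by
  have h : Continuous fun x => ContinuousLinearMap.smulRightL ℂ H1 H1 (eval x) :=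
    (ContinuousLinearMap.smulRightL ℂ H1 H1).continuous.comp continuous_eval
  exact h.clm_apply continuous_kernel

theorem pointForm_mem_finiteRank (x : ℝ) : pointForm x ∈ FormPencil.finiteRank H1 := by
  rw [FormPencil.mem_finiteRank]
  refine Submodule.finiteDimensional_of_le (S₂ := ℂ ∙ kernel x) ?_
  rintro _ ⟨p, rfl⟩
  exact Submodule.mem_span_singleton.2 ⟨eval x p, (pointForm_apply x p).symm⟩

theorem integrable_smul_pointForm {V : ℝ → ℂ} (hV : Integrable V) :
    Integrable fun x => V x • pointForm x := by
  refine hV.smul_bdd 4 continuous_pointForm.aestronglyMeasurable (Eventually.of_forall fun x => ?_)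
  rw [pointForm, ContinuousLinearMap.norm_smulRight_apply]
  nlinarith [norm_kernel_le x, norm_nonneg (kernel x), norm_eval_le x]

/-- The form `p, q ↦ ∫ V p conj q` as an operator. -/
def potential (V : ℝ → ℂ) : H1 →L[ℂ] H1 := ∫ x, V x • pointForm x

theorem inner_potential {V : ℝ → ℂ} (hV : Integrable V) (p q : H1) :
    inner ℂ q (potential V p) = ∫ x, V x * incl p x * starRingEnd ℂ (incl q x) := by
  have h1 : potential V p = ∫ x, (V x • pointForm x) p :=
    ContinuousLinearMap.integral_apply (integrable_smul_pointForm hV) p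
  rw [h1, ← integral_inner ((integrable_smul_pointForm hV).apply_continuousLinearMap p)]
  refine integral_congr_ae ?_
  filter_upwards [ae_eq_eval p, ae_eq_eval q] with x hp hq
  rw [smul_apply, pointForm_apply, inner_smul_right, inner_smul_right, hp, hq, ← inner_kernel x q,
    inner_conj_symm, mul_assoc]

theorem norm_inner_potential_le {V : ℝ → ℂ} (hV : Integrable V) (p q : H1) {c : ℝ}
    (h : ∀ x, ‖eval x p‖ * ‖eval x q‖ ≤ c) :
    ‖inner ℂ q (potential V p)‖ ≤ (∫ x, ‖V x‖) * c := by
  rw [inner_potential hV, ← integral_mul_const]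
  refine norm_integral_le_of_norm_le (hV.norm.mul_const c) ?_
  filter_upwards [ae_eq_eval p, ae_eq_eval q] with x hp hq
  rw [norm_mul, norm_mul, RCLike.norm_conj, hp, hq, mul_assoc]
  exact mul_le_mul_of_nonneg_left (h x) (norm_nonneg _)

/-- A Bochner integral of elements of a closed subspace stays in it: its image in the quotient is
the integral of zero. -/
theorem potential_mem_closure (V : ℝ → ℂ) :
    potential V ∈ (FormPencil.finiteRank H1).topologicalClosure := by
  by_cases hV : Integrable fun x => V x • pointForm x
  · set S := (FormPencil.finiteRank H1).topologicalClosure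
    have : IsClosed (S : Set (H1 →L[ℂ] H1)) := Submodule.isClosed_topologicalClosure _
    have h1 : S.mkQL (potential V) = 0 := by
      rw [potential, ← ContinuousLinearMap.integral_comp_comm _ hV]
      refine integral_eq_zero_of_ae (Eventually.of_forall fun x => ?_)
      exact (Submodule.Quotient.mk_eq_zero S).2 (S.smul_mem _
        (Submodule.le_topologicalClosure _ (pointForm_mem_finiteRank x)))
    exact (Submodule.Quotient.mk_eq_zero S).1 h1
  -- Without integrability the integral takes its default value $0$.
  · rw [potential, integral_undef hV]
    exact Submodule.zero_mem _

end H1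

end StepSchrodinger

namespace StepSchrodinger

open Filter Topology ContinuousLinearMap

/-! ### Multiplication by smooth functions -/

theorem norm_le_of_ae_norm_sq_le {u v w : L2} {a b : ℝ}
    (h : ∀ᵐ x, ‖w x‖ ^ 2 ≤ a * ‖u x‖ ^ 2 + b * ‖v x‖ ^ 2) :
    ‖w‖ ^ 2 ≤ a * ‖u‖ ^ 2 + b * ‖v‖ ^ 2 := by
  simp only [norm_sq_eq_integral]
  rw [← integral_const_mul, ← integral_const_mul,
    ← integral_add ((integrable_norm_sq u).const_mul a) ((integrable_norm_sq v).const_mul b)]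
  exact integral_mono_ae (integrable_norm_sq w)
    (((integrable_norm_sq u).const_mul a).add ((integrable_norm_sq v).const_mul b)) h

theorem memLp_mul {g : ℝ → ℂ} (hg : AEStronglyMeasurable g) {c : ℝ} (hc : ∀ x, ‖g x‖ ≤ c)
    (u : L2) : MemLp (fun x => g x * u x) 2 := by
  refine (Lp.memLp u).of_le_mul (c := c) (hg.mul (Lp.aestronglyMeasurable u))
    (Eventually.of_forall fun x => ?_)
  rw [norm_mul]
  exact mul_le_mul_of_nonneg_right (hc x) (norm_nonneg _)

theorem integrable_conj_mul (u v : L2) : Integrable fun x => starRingEnd ℂ (u x) * v x := by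
  simpa [mul_comm] using integrable_mul_conj v u

/-- Temperate growth keeps $gf$ a Schwartz function, so the product rule follows by testing the
derivative of $u$ against $gf$. -/
theorem IsWeakDeriv.mul {g : ℝ → ℝ} (hg : g.HasTemperateGrowth) {c d : ℝ} (hc : ∀ x, ‖g x‖ ≤ c)
    (hd : ∀ x, ‖deriv g x‖ ≤ d) {u v u' v' : L2} (h : IsWeakDeriv u v)
    (hu' : ∀ᵐ x, u' x = g x * u x) (hv' : ∀ᵐ x, v' x = deriv g x * u x + g x * v x) :
    IsWeakDeriv u' v' := by
  have hG : (fun x => (g x : ℂ)).HasTemperateGrowth := by fun_prop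
  have hgd : Differentiable ℝ g := hg.1.differentiable (by simp)
  refine isWeakDeriv_iff.2 fun f => ?_
  set F : 𝓢(ℝ, ℂ) := SchwartzMap.smulLeftCLM ℂ (fun x => (g x : ℂ)) f with hF
  have hFx : ∀ x, F x = g x * f x := fun x => by
    rw [hF, SchwartzMap.smulLeftCLM_apply_apply hG, smul_eq_mul]
  have hF' : ∀ x, (∂_{(1 : ℝ)} F) x = deriv g x * f x + g x * (∂_{(1 : ℝ)} f) x := fun x => by
    rw [lineDeriv_one_apply, lineDeriv_one_apply]
    have h1 : HasDerivAt (fun x => (g x : ℂ) * f x)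
        ((deriv g x : ℝ) * f x + g x * deriv f x) x :=
      ((hgd x).hasDerivAt.ofReal_comp).mul (f.hasDerivAt x)
    have h2 : (F : ℝ → ℂ) = fun x => (g x : ℂ) * f x := funext hFx
    rw [h2]
    exact h1.deriv
  have h1 := isWeakDeriv_iff.1 h F
  rw [inner_toLp, inner_toLp] at h1 ⊢
  have hgm : AEStronglyMeasurable (fun x => (g x : ℂ)) :=
    (Complex.continuous_ofReal.comp hgd.continuous).aestronglyMeasurable
  have hg'm : AEStronglyMeasurable (fun x => ((deriv g x : ℝ) : ℂ)) :=
    (Complex.measurable_ofReal.comp (measurable_deriv g)).aestronglyMeasurable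
  have i1 : Integrable fun x => starRingEnd ℂ (f x) * (deriv g x * u x) := by
    have := integrable_conj_mul (f.toLp 2 volume)
      ((memLp_mul hg'm (c := d) (by simpa using hd) u).toLp _)
    refine this.congr ?_
    filter_upwards [f.coeFn_toLp 2 volume, MemLp.coeFn_toLp (memLp_mul hg'm (c := d)
      (by simpa using hd) u)] with x h1 h2
    rw [h1, h2]
  have i2 : Integrable fun x => starRingEnd ℂ ((∂_{(1 : ℝ)} f) x) * (g x * u x) := by
    have := integrable_conj_mul ((∂_{(1 : ℝ)} f).toLp 2 volume)
      ((memLp_mul hgm (c := c) (by simpa using hc) u).toLp _)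
    refine this.congr ?_
    filter_upwards [(∂_{(1 : ℝ)} f).coeFn_toLp 2 volume, MemLp.coeFn_toLp (memLp_mul hgm (c := c)
      (by simpa using hc) u)] with x h1 h2
    rw [h1, h2]
  have i3 : Integrable fun x => starRingEnd ℂ (f x) * (g x * v x) := by
    have := integrable_conj_mul (f.toLp 2 volume)
      ((memLp_mul hgm (c := c) (by simpa using hc) v).toLp _)
    refine this.congr ?_
    filter_upwards [f.coeFn_toLp 2 volume, MemLp.coeFn_toLp (memLp_mul hgm (c := c)
      (by simpa using hc) v)] with x h1 h2
    rw [h1, h2]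
  have e1 : ∫ x, starRingEnd ℂ ((∂_{(1 : ℝ)} F) x) * u x =
      (∫ x, starRingEnd ℂ (f x) * (deriv g x * u x)) +
        ∫ x, starRingEnd ℂ ((∂_{(1 : ℝ)} f) x) * (g x * u x) := by
    rw [← integral_add i1 i2]
    refine integral_congr_ae (Eventually.of_forall fun x => ?_)
    simp only [hF', map_add, map_mul, conj_ofReal]
    ring
  have e2 : ∫ x, starRingEnd ℂ (F x) * v x = ∫ x, starRingEnd ℂ (f x) * (g x * v x) := by
    refine integral_congr_ae (Eventually.of_forall fun x => ?_)
    simp only [hFx, map_mul, conj_ofReal]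
    ring
  have e3 : ∫ x, starRingEnd ℂ ((∂_{(1 : ℝ)} f) x) * u' x =
      ∫ x, starRingEnd ℂ ((∂_{(1 : ℝ)} f) x) * (g x * u x) := by
    refine integral_congr_ae ?_
    filter_upwards [hu'] with x hx
    rw [hx]
  have e4 : ∫ x, starRingEnd ℂ (f x) * v' x =
      (∫ x, starRingEnd ℂ (f x) * (deriv g x * u x)) +
        ∫ x, starRingEnd ℂ (f x) * (g x * v x) := by
    rw [← integral_add i1 i3]
    refine integral_congr_ae ?_
    filter_upwards [hv'] with x hx
    rw [hx, mul_add]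
  rw [e3, e4]
  rw [e1, e2] at h1
  linear_combination h1

namespace H1

theorem exists_mul {g : ℝ → ℝ} (hg : g.HasTemperateGrowth) {c d : ℝ} (hc : ∀ x, ‖g x‖ ≤ c)
    (hd : ∀ x, ‖deriv g x‖ ≤ d) (p : H1) :
    ∃ r : H1, (∀ᵐ x, incl r x = g x * incl p x) ∧
      ∀ᵐ x, der r x = deriv g x * incl p x + g x * der p x := by
  have hgd : Differentiable ℝ g := hg.1.differentiable (by simp)
  have hgm : AEStronglyMeasurable (fun x => (g x : ℂ)) :=
    (Complex.continuous_ofReal.comp hgd.continuous).aestronglyMeasurable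
  have hg'm : AEStronglyMeasurable (fun x => ((deriv g x : ℝ) : ℂ)) :=
    (Complex.measurable_ofReal.comp (measurable_deriv g)).aestronglyMeasurable
  have m1 := memLp_mul hgm (c := c) (by simpa using hc) (incl p)
  have m2 := (memLp_mul hg'm (c := d) (by simpa using hd) (incl p)).add
    (memLp_mul hgm (c := c) (by simpa using hc) (der p))
  exact ⟨mk (m1.toLp _) (m2.toLp _)
    ((isWeakDeriv p).mul hg hc hd m1.coeFn_toLp m2.coeFn_toLp), m1.coeFn_toLp, m2.coeFn_toLp⟩

/-! ### Operators represented by a potential -/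

/-- `A` represents the form `∫ p' conj r' + ∫ q p conj r`. -/
def HasPotential (A : H1 →L[ℂ] H1) (q : ℝ → ℂ) : Prop :=
  ∀ p r : H1, Integrable (fun x => q x * incl p x * starRingEnd ℂ (incl r x)) ∧
    inner ℂ r (A p) = inner ℂ (der r) (der p) + ∫ x, q x * incl p x * starRingEnd ℂ (incl r x)

theorem HasPotential.adjoint {A : H1 →L[ℂ] H1} {q : ℝ → ℂ} (h : HasPotential A q) :
    HasPotential (adjoint A) fun x => starRingEnd ℂ (q x) := by
  intro p r
  have heq : ∀ x, starRingEnd ℂ (q x) * incl p x * starRingEnd ℂ (incl r x) =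
      starRingEnd ℂ (q x * incl r x * starRingEnd ℂ (incl p x)) := fun x => by
    simp only [map_mul, conj_conj]
    ring
  obtain ⟨h1, h2⟩ := h r p
  constructor
  · simp_rw [heq]
    exact (conjLIE.toContinuousLinearEquiv : ℂ →L[ℝ] ℂ).integrable_comp h1
  · simp_rw [heq]
    rw [adjoint_inner_right, ← inner_conj_symm, h2, map_add, inner_conj_symm, integral_conj]

/-- A lower bound from the multiplier `1 - i g`. -/
theorem HasPotential.exists_norm_le {A : H1 →L[ℂ] H1} {q : ℝ → ℂ} (hA : HasPotential A q)
    {g : ℝ → ℝ} (hg : g.HasTemperateGrowth) {c d : ℝ} (hc : ∀ x, ‖g x‖ ≤ c)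
    (hd : ∀ x, ‖deriv g x‖ ≤ d) {δ : ℝ} (hδ : 0 < δ) (hδ' : δ ≤ 1 / 2)
    (hq : ∀ᵐ x, δ + deriv g x ^ 2 / 2 ≤ (q x).re - g x * (q x).im) :
    ∃ a > 0, ∀ p, a * ‖p‖ ≤ ‖A p‖ := by
  have hc0 : 0 ≤ c := (norm_nonneg _).trans (hc 0)
  have hd0 : 0 ≤ d := (norm_nonneg _).trans (hd 0)
  -- The denominator bounds the norm of $p\mapsto w=p-igp$ on $W^{1,2}$; $w$ is the test vector
  -- below.
  refine ⟨δ / (1 + (c + d + c)), by positivity, fun p => ?_⟩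
  obtain ⟨r, hr, hr'⟩ := exists_mul hg hc hd p
  have hnr : ‖r‖ ≤ (c + d + c) * ‖p‖ := by
    have n1 : ‖incl r‖ ≤ c * ‖incl p‖ := Lp.norm_le_mul_norm_of_ae_le_mul <| by
      filter_upwards [hr] with x hx
      rw [hx, norm_mul, norm_real]
      exact mul_le_mul_of_nonneg_right (hc x) (norm_nonneg _)
    have n2 : ‖der r‖ ≤ (d + c) * ‖p‖ := by
      refine le_of_sq_le_sq ?_ (by positivity)
      have : ‖der r‖ ^ 2 ≤ (d ^ 2 + d * c) * ‖incl p‖ ^ 2 + (c ^ 2 + d * c) * ‖der p‖ ^ 2 :=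
        norm_le_of_ae_norm_sq_le <| by
          filter_upwards [hr'] with x hx
          rw [hx]
          have h1 := norm_add_le (((deriv g x : ℝ) : ℂ) * incl p x) (g x * der p x)
          rw [norm_mul, norm_mul, norm_real, norm_real] at h1
          have h2 := mul_le_mul_of_nonneg_right (hd x) (norm_nonneg (incl p x))
          have h3 := mul_le_mul_of_nonneg_right (hc x) (norm_nonneg (der p x))
          have h4 := pow_le_pow_left₀ (norm_nonneg _) (h1.trans (add_le_add h2 h3)) 2
          nlinarith [mul_nonneg (mul_nonneg hd0 hc0) (sq_nonneg (‖incl p x‖ - ‖der p x‖))]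
      rw [mul_pow, norm_sq_eq]
      nlinarith [mul_nonneg hd0 hc0, sq_nonneg ‖incl p‖, sq_nonneg ‖der p‖,
        mul_nonneg (sq_nonneg d) (sq_nonneg ‖der p‖), mul_nonneg (sq_nonneg c) (sq_nonneg ‖incl p‖),
        mul_nonneg (mul_nonneg hd0 hc0) (sq_nonneg ‖der p‖),
        mul_nonneg (mul_nonneg hd0 hc0) (sq_nonneg ‖incl p‖)]
    have n3 : ‖r‖ ≤ ‖incl r‖ + ‖der r‖ := by
      refine le_of_sq_le_sq ?_ (by positivity)
      rw [norm_sq_eq]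
      nlinarith [norm_nonneg (incl r), norm_nonneg (der r)]
    nlinarith [norm_incl_le p]
  set w : H1 := p - I • r with hw
  have hwi : ∀ᵐ x, incl w x = incl p x - I * (g x * incl p x) := by
    have : incl w = incl p - I • incl r := by rw [hw, map_sub, map_smul]
    rw [this]
    filter_upwards [Lp.coeFn_sub (incl p) (I • incl r), Lp.coeFn_smul I (incl r), hr] with x h1 h2 h3
    rw [h1, Pi.sub_apply, h2, Pi.smul_apply, h3, smul_eq_mul]
  have hwd : ∀ᵐ x, der w x = der p x - I * (deriv g x * incl p x + g x * der p x) := by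
    have : der w = der p - I • der r := by rw [hw, map_sub, map_smul]
    rw [this]
    filter_upwards [Lp.coeFn_sub (der p) (I • der r), Lp.coeFn_smul I (der r), hr'] with x h1 h2 h3
    rw [h1, Pi.sub_apply, h2, Pi.smul_apply, h3, smul_eq_mul]
  have hwn : ‖w‖ ≤ (1 + (c + d + c)) * ‖p‖ := by
    have := norm_sub_le p (I • r)
    rw [norm_smul, norm_I, one_mul] at this
    linarith
  obtain ⟨h1, h2⟩ := hA p w
  -- The integrand has real part $|p'|^2+g'\,\mathrm{Re}(ip'\bar
  -- p)+(\mathrm{Re}\,q-g\,\mathrm{Im}\,q)|p|^2$. The cross term costs at most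
  -- $\frac12|p'|^2+\frac12 g'^2|p|^2$, which explains the bound $\delta\le\frac12$ and the term
  -- $g'^2/2$ in the hypothesis.
  have hlow : δ * ‖p‖ ^ 2 ≤ (inner ℂ w (A p)).re := by
    rw [h2, L2.inner_def]
    have i1 : Integrable fun x => inner ℂ (der w x) (der p x) := L2.integrable_inner _ _
    rw [← integral_add i1 h1]
    have i2 := i1.add h1
    have e1 : (∫ x, (inner ℂ (der w x) (der p x) +
        q x * incl p x * starRingEnd ℂ (incl w x))).re =
        ∫ x, (inner ℂ (der w x) (der p x) + q x * incl p x * starRingEnd ℂ (incl w x)).re :=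
      (reCLM.integral_comp_comm i2).symm
    rw [e1, norm_sq_eq, norm_sq_eq_integral, norm_sq_eq_integral,
      ← integral_add (integrable_norm_sq _) (integrable_norm_sq _), ← integral_const_mul]
    refine integral_mono_ae (((integrable_norm_sq _).add (integrable_norm_sq _)).const_mul δ)
      (reCLM.integrable_comp i2) ?_
    filter_upwards [hwi, hwd, hq] with x hx1 hx2 hx3
    rw [hx1, hx2, RCLike.inner_apply, ← normSq_eq_norm_sq, ← normSq_eq_norm_sq]
    generalize incl p x = b at *
    generalize der p x = a at *
    generalize q x = e at *
    generalize g x = m at *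
    generalize deriv g x = n at *
    obtain ⟨a1, a2⟩ := a
    obtain ⟨b1, b2⟩ := b
    obtain ⟨e1, e2⟩ := e
    simp [normSq_apply] at hx3 ⊢
    nlinarith [mul_le_mul_of_nonneg_right hx3 (add_nonneg (sq_nonneg b1) (sq_nonneg b2)),
      sq_nonneg (a1 + n * b2), sq_nonneg (a2 - n * b1),
      mul_le_mul_of_nonneg_right hδ' (add_nonneg (sq_nonneg a1) (sq_nonneg a2))]
  have hup : (inner ℂ w (A p)).re ≤ ‖w‖ * ‖A p‖ := re_inner_le_norm (𝕜 := ℂ) w (A p)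
  have h3 : δ * ‖p‖ ^ 2 ≤ (1 + (c + d + c)) * ‖p‖ * ‖A p‖ :=
    hlow.trans (hup.trans (mul_le_mul_of_nonneg_right hwn (norm_nonneg _)))
  rw [div_mul_eq_mul_div, div_le_iff₀ (by positivity)]
  rcases (norm_nonneg p).eq_or_lt with h0 | h0
  · rw [← h0, mul_zero]
    positivity
  · refine le_of_mul_le_mul_right ?_ h0
    linarith

/-- The adjoint has potential $\bar q$, for which $-g$ satisfies the same inequality. Lowering
$\delta$ to at most $\frac12$ loses nothing. -/
theorem HasPotential.isUnit {A : H1 →L[ℂ] H1} {q : ℝ → ℂ} (hA : HasPotential A q)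
    {g : ℝ → ℝ} (hg : g.HasTemperateGrowth) {c d : ℝ} (hc : ∀ x, ‖g x‖ ≤ c)
    (hd : ∀ x, ‖deriv g x‖ ≤ d) {δ : ℝ} (hδ : 0 < δ)
    (hq : ∀ᵐ x, δ + deriv g x ^ 2 / 2 ≤ (q x).re - g x * (q x).im) : IsUnit A := by
  have hδ2 : 0 < min δ (1 / 2) := lt_min hδ one_half_pos
  have hq2 : ∀ᵐ x, min δ (1 / 2) + deriv g x ^ 2 / 2 ≤ (q x).re - g x * (q x).im := by
    filter_upwards [hq] with x hx
    linarith [min_le_left δ (1 / 2)]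
  obtain ⟨a, ha, h1⟩ := hA.exists_norm_le hg hc hd hδ2 (min_le_right _ _) hq2
  obtain ⟨b, hb, h2⟩ := hA.adjoint.exists_norm_le (g := -g) hg.neg (c := c) (d := d)
    (by simpa using hc) (by simpa [deriv.neg] using hd) hδ2 (min_le_right _ _) (by
      filter_upwards [hq2] with x hx
      simpa [deriv.neg] using hx)
  refine FormPencil.isUnit_of_bounded_below (lt_min ha hb) (fun p => ?_) fun p => ?_
  · exact (mul_le_mul_of_nonneg_right (min_le_left _ _) (norm_nonneg _)).trans (h1 p)
  · exact (mul_le_mul_of_nonneg_right (min_le_right _ _) (norm_nonneg _)).trans (h2 p)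

end H1

end StepSchrodinger

namespace StepSchrodinger

open Filter Topology ContinuousLinearMap FormPencil H1

/-! ### The form operators -/

/-- Multiplication by `i sgn x` in `L²(ℝ)`. -/
def stepMul : L2 →L[ℂ] L2 :=
  LinearMap.mkContinuous
    { toFun := fun u => stepPotential • u
      map_add' := fun _ _ => Lp.add_smul _ _ _
      map_smul' := fun _ _ => (Lp.smul_comm _ _ _).symm }
    ‖stepPotential‖ fun _ => Lp.norm_smul_le _ _

theorem stepMul_apply (u : L2) : stepMul u = stepPotential • u := rfl

theorem stepMul_ae (u : L2) : ∀ᵐ x, stepMul u x = I * (Real.sign x : ℂ) * u x := by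
  rw [stepMul_apply]
  filter_upwards [Lp.coeFn_lpSMul (r := 2) stepPotential u, memLp_stepPotential.coeFn_toLp]
    with x h1 h2
  rw [h1, Pi.smul_apply', smul_eq_mul]
  exact congrArg (· * u x) h2

/-- The operator on `W^{1,2}(ℝ)` that represents the form
`∫ p' conj r' + i ∫ sgn p conj r + ∫ W p conj r`. -/
def formOp (W : ℝ → ℂ) : H1 →L[ℂ] H1 :=
  adjoint der ∘L der + adjoint incl ∘L stepMul ∘L incl + potential W

theorem inner_formOp {W : ℝ → ℂ} (hW : Integrable W) (p r : H1) :
    inner ℂ r (formOp W p) = inner ℂ (der r) (der p) + inner ℂ (incl r) (stepMul (incl p)) +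
      ∫ x, W x * incl p x * starRingEnd ℂ (incl r x) := by
  rw [formOp, add_apply, add_apply, inner_add_right, inner_add_right, inner_potential hW,
    comp_apply, comp_apply, comp_apply, adjoint_inner_right, adjoint_inner_right]

theorem inner_eq_integral (u v : L2) : inner ℂ u v = ∫ x, v x * starRingEnd ℂ (u x) := by
  rw [L2.inner_def]
  rfl

theorem eq_adjoint_incl_iff (p : H1) (η : L2) :
    p = adjoint incl η ↔ ∀ r : H1, inner ℂ r p = inner ℂ (incl r) η := by
  refine ⟨fun h r => by rw [h, adjoint_inner_right], fun h => ext_inner_left ℂ fun r => ?_⟩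
  rw [h, adjoint_inner_right]

theorem mem_W12_incl (p : H1) : incl p ∈ W12 := ⟨der p, isWeakDeriv p⟩

/-- Elements of `W12` as elements of the Hilbert space. -/
def ofW12 (ψ : W12) : H1 := H1.mk ψ (weakDeriv ψ) (isWeakDeriv_weakDeriv ψ)

theorem ofW12_incl (p : H1) : ofW12 ⟨incl p, mem_W12_incl p⟩ = p := incl_injective rfl

theorem integrable_mul_mul_conj_incl {W : ℝ → ℂ} (hW : Integrable W) (p r : H1) :
    Integrable fun x => W x * incl p x * starRingEnd ℂ (incl r x) :=
  integrable_mul_mul_conj hW ⟨incl p, mem_W12_incl p⟩ ⟨incl r, mem_W12_incl r⟩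

theorem inner_stepMul (u v : L2) : inner ℂ v (stepMul u) =
    I * (∫ x in Set.Ioi (0 : ℝ), u x * starRingEnd ℂ (v x)) -
      I * ∫ x in Set.Iio (0 : ℝ), u x * starRingEnd ℂ (v x) := by
  have hi := integrable_mul_conj u v
  rw [inner_eq_integral, ← integral_indicator measurableSet_Ioi,
    ← integral_indicator measurableSet_Iio, ← integral_const_mul, ← integral_const_mul,
    ← integral_sub ((hi.indicator measurableSet_Ioi).const_mul I)
      ((hi.indicator measurableSet_Iio).const_mul I)]
  refine integral_congr_ae ?_
  filter_upwards [stepMul_ae u] with x hx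
  rw [hx]
  rcases lt_trichotomy x 0 with h | h | h
  · simp [Real.sign_of_neg h, h, h.le, mul_assoc]
  · simp [h]
  · simp [Real.sign_of_pos h, h, h.le, mul_assoc]

theorem formH_eq_inner {V : ℝ → ℂ} (hV : Integrable V) (ε : ℝ) (ψ φ : W12) :
    formH V ε ψ φ = inner ℂ (ofW12 φ) (formOp (fun x => ε * V x) (ofW12 ψ)) := by
  have h : (∫ x, ε * V x * (ψ : L2) x * starRingEnd ℂ ((φ : L2) x)) =
      ε * ∫ x, V x * (ψ : L2) x * starRingEnd ℂ ((φ : L2) x) := by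
    rw [← integral_const_mul]
    simp only [mul_assoc]
  rw [inner_formOp (hV.const_mul _), inner_stepMul, formH, inner_eq_integral]
  simp only [ofW12, incl_mk, der_mk, h]
  ring

theorem represents_iff {V : ℝ → ℂ} (hV : Integrable V) (ε : ℝ) (ψ : W12) (η : L2) :
    Represents V ε ψ η ↔ formOp (fun x => ε * V x) (ofW12 ψ) = adjoint incl η := by
  rw [eq_adjoint_incl_iff]
  constructor
  · intro h r
    have h1 := h ⟨incl r, mem_W12_incl r⟩
    rwa [formH_eq_inner hV, ofW12_incl] at h1
  · intro h φ
    rw [formH_eq_inner hV, h]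
    rfl

theorem isAssociated_opHPert {V : ℝ → ℂ} (hV : Integrable V) (ε : ℝ) :
    IsAssociated (opHPert hV ε) incl (formOp fun x => ε * V x) := by
  have hspec : ∀ ψ : domH hV ε, Represents V ε (Submodule.inclusion (domH_le_W12 hV ε) ψ)
      (opHPert hV ε ψ) := fun ψ => (exists_represents ψ).choose_spec
  intro ψ η
  constructor
  · rintro ⟨hψ, rfl⟩
    exact ⟨ofW12 ⟨ψ, domH_le_W12 hV ε hψ⟩, rfl, (represents_iff hV ε _ _).1 (hspec ⟨ψ, hψ⟩)⟩
  · rintro ⟨p, rfl, hp⟩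
    have hR : Represents V ε ⟨incl p, mem_W12_incl p⟩ η := by
      rw [represents_iff hV, ofW12_incl]
      exact hp
    have hdom : incl p ∈ (opHPert hV ε).domain := ⟨mem_W12_incl p, η, hR⟩
    exact ⟨hdom, (hspec ⟨incl p, hdom⟩).unique hR⟩

/-- One direction is integration by parts. In the other, testing with Schwartz functions identifies
the weak derivative of $p'$ as an $L^2$ function, which gives $W^{2,2}$ regularity. -/
theorem isAssociated_opH : IsAssociated opH incl (formOp 0) := by
  have h0 : ∀ p r : H1, inner ℂ r (formOp 0 p) =
      inner ℂ (der r) (der p) + inner ℂ (incl r) (stepMul (incl p)) := fun p r => by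
    rw [inner_formOp (integrable_zero _ _ _)]
    simp
  intro ψ η
  constructor
  · rintro ⟨hψ, rfl⟩
    have hψ1 : ψ ∈ W12 := W22_le_W12 hψ
    refine ⟨ofW12 ⟨ψ, hψ1⟩, rfl, (eq_adjoint_incl_iff _ _).2 fun r => ?_⟩
    have h2 : IsWeakDeriv (weakDeriv ⟨ψ, hψ1⟩) (weakDeriv2 ⟨ψ, hψ⟩) :=
      isWeakDeriv_weakDeriv ⟨_, weakDeriv_mem_W12 ⟨ψ, hψ⟩⟩
    rw [h0, show der (ofW12 ⟨ψ, hψ1⟩) = weakDeriv ⟨ψ, hψ1⟩ from rfl, inner_der_eq r h2]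
    change _ = inner ℂ (incl r) (-weakDeriv2 ⟨ψ, hψ⟩ + stepMul ψ)
    rw [inner_add_right, inner_neg_right]
    rfl
  · rintro ⟨p, rfl, hp⟩
    rw [eq_adjoint_incl_iff] at hp
    have h2 : IsWeakDeriv (der p) (stepMul (incl p) - η) := isWeakDeriv_iff.2 fun f => by
      have := hp (ofSchwartz f)
      rw [h0, incl_ofSchwartz, der_ofSchwartz] at this
      rw [inner_sub_right, ← this]
      ring
    set u : W12 := ⟨incl p, mem_W12_incl p⟩
    have hu : weakDeriv u = der p := (isWeakDeriv_weakDeriv u).unique (isWeakDeriv p)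
    have hdom : incl p ∈ W22 := by
      refine ⟨u, ?_, rfl⟩
      change weakDeriv u ∈ W12
      rw [hu]
      exact ⟨_, h2⟩
    refine ⟨hdom, ?_⟩
    have h3 : IsWeakDeriv (der p) (weakDeriv2 ⟨incl p, hdom⟩) := by
      rw [← hu]
      exact isWeakDeriv_weakDeriv ⟨_, weakDeriv_mem_W12 ⟨incl p, hdom⟩⟩
    change -weakDeriv2 ⟨incl p, hdom⟩ + stepMul (incl p) = η
    rw [h3.unique h2]
    abel

/-! ### Invertibility off the two half-lines -/

theorem hasPotential_pencil {U : ℝ → ℂ} (hU : Integrable U) (z : ℂ) :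
    HasPotential (pencil incl (formOp U) z) fun x => I * (Real.sign x : ℂ) - z + U x := by
  intro p r
  have i1 : Integrable fun x => stepMul (incl p) x * starRingEnd ℂ (incl r x) :=
    integrable_mul_conj _ _
  have i2 : Integrable fun x => z * (incl p x * starRingEnd ℂ (incl r x)) :=
    (integrable_mul_conj _ _).const_mul z
  have i3 := integrable_mul_mul_conj_incl hU p r
  have hae : (fun x => (I * (Real.sign x : ℂ) - z + U x) * incl p x * starRingEnd ℂ (incl r x))
      =ᵐ[volume] fun x => stepMul (incl p) x * starRingEnd ℂ (incl r x) -
        z * (incl p x * starRingEnd ℂ (incl r x)) + U x * incl p x * starRingEnd ℂ (incl r x) := by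
    filter_upwards [stepMul_ae (incl p)] with x hx
    rw [hx]
    ring
  refine ⟨((i1.sub i2).add i3).congr hae.symm, ?_⟩
  have i12 : Integrable fun x => stepMul (incl p) x * starRingEnd ℂ (incl r x) -
        z * (incl p x * starRingEnd ℂ (incl r x)) := i1.sub i2
  rw [integral_congr_ae hae, integral_add i12 i3, integral_sub i1 i2, integral_const_mul,
    ← inner_eq_integral, ← inner_eq_integral, pencil_apply, inner_sub_right, inner_smul_right,
    adjoint_inner_right, inner_formOp hU]
  ring

/-! ### A smooth multiplier and the auxiliary potential -/

/-- The smooth step `x / √(1 + x²)`. -/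
def smoothStep (x : ℝ) : ℝ := x * (1 + ‖x‖ ^ 2) ^ (-1 / 2 : ℝ)

theorem hasTemperateGrowth_smoothStep : smoothStep.HasTemperateGrowth := by
  unfold smoothStep
  fun_prop

theorem smoothStep_eq (x : ℝ) : smoothStep x = x / √(1 + x ^ 2) := by
  have h1 : (1 + x ^ 2) ^ (-1 / 2 : ℝ) = (√(1 + x ^ 2))⁻¹ := by
    rw [Real.sqrt_eq_rpow, ← Real.rpow_neg (by positivity)]
    norm_num
  rw [smoothStep, Real.norm_eq_abs, sq_abs, h1, div_eq_mul_inv]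

theorem hasDerivAt_smoothStep (x : ℝ) :
    HasDerivAt smoothStep (((1 + x ^ 2) * √(1 + x ^ 2))⁻¹) x := by
  have hpos : (0 : ℝ) < 1 + x ^ 2 := by positivity
  have hs := Real.sqrt_pos.2 hpos
  have h1 : HasDerivAt (fun x : ℝ => 1 + x ^ 2) (2 * x) x := by
    simpa using ((hasDerivAt_id x).pow 2).const_add 1
  have h2 := (hasDerivAt_id x).div (h1.sqrt hpos.ne') hs.ne'
  have h3 : smoothStep = fun x => x / √(1 + x ^ 2) := funext smoothStep_eq
  rw [h3]
  refine h2.congr_deriv ?_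
  have hsq : √(1 + x ^ 2) ^ 2 = 1 + x ^ 2 := Real.sq_sqrt hpos.le
  have hne := hs.ne'
  simp only [id_eq, one_mul]
  generalize √(1 + x ^ 2) = r at *
  rw [← hsq]
  field_simp
  linarith

theorem deriv_smoothStep_sq_le (x : ℝ) : deriv smoothStep x ^ 2 ≤ (1 + x ^ 2)⁻¹ := by
  rw [(hasDerivAt_smoothStep x).deriv, inv_pow]
  have h1 : 1 ≤ 1 + x ^ 2 := by nlinarith [sq_nonneg x]
  refine inv_anti₀ (by positivity) ?_
  rw [mul_pow, Real.sq_sqrt (by positivity)]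
  nlinarith [mul_nonneg (sq_nonneg x) (sq_nonneg x), sq_nonneg x,
    mul_nonneg (mul_nonneg (sq_nonneg x) (sq_nonneg x)) (sq_nonneg x)]

theorem abs_smoothStep_sub_sign_le {x : ℝ} (hx : x ≠ 0) :
    |smoothStep x - Real.sign x| ≤ (1 + x ^ 2)⁻¹ := by
  have hpos : (0 : ℝ) < 1 + x ^ 2 := by positivity
  have hs := Real.sqrt_pos.2 hpos
  have hsq : √(1 + x ^ 2) ^ 2 = 1 + x ^ 2 := Real.sq_sqrt hpos.le
  have hle : |x| ≤ √(1 + x ^ 2) := Real.abs_le_sqrt (by linarith)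
  have key : ∀ y : ℝ, 0 ≤ y → y ≤ √(1 + x ^ 2) → y ^ 2 = x ^ 2 →
      |y / √(1 + x ^ 2) - 1| ≤ (1 + x ^ 2)⁻¹ := by
    intro y hy0 hy hyx
    rw [abs_sub_comm, abs_of_nonneg (sub_nonneg.2 ((div_le_one hs).2 hy))]
    have h1 : √(1 + x ^ 2) ^ 2 = 1 + y ^ 2 := by rw [hsq, hyx]
    generalize √(1 + x ^ 2) = r at *
    have h2 : 1 - y / r = (r - y) * r / r ^ 2 := by field_simp
    rw [h2, ← hsq, inv_eq_one_div]
    refine div_le_div_of_nonneg_right ?_ (by positivity)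
    nlinarith [mul_nonneg hy0 (sub_nonneg.2 hy)]
  rw [smoothStep_eq]
  rcases lt_or_gt_of_ne hx with h | h
  · have := key (-x) (by linarith) (by rwa [abs_of_neg h] at hle) (by ring)
    rw [Real.sign_of_neg h]
    rw [← abs_neg]
    convert this using 2
    ring
  · rw [Real.sign_of_pos h]
    exact key x h.le (by rwa [abs_of_pos h] at hle) rfl

theorem abs_smoothStep_le (x : ℝ) : |smoothStep x| ≤ 1 := by
  have hpos : (0 : ℝ) < 1 + x ^ 2 := by positivity
  rw [smoothStep_eq, abs_div, abs_of_pos (Real.sqrt_pos.2 hpos), div_le_one (Real.sqrt_pos.2 hpos)]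
  exact Real.abs_le_sqrt (by linarith)

/-- The asserted essential spectrum. -/
def halfLines : Set ℂ := {z : ℂ | 0 ≤ z.re ∧ (z.im = -1 ∨ z.im = 1)}

/-- A point off the ray $i\sigma+[0,\infty)$ is strictly separated from it by a line. The quantity
is $\mathrm{Re}\,q-\tau\,\mathrm{Im}\,q$ for the constant potential $q=i\sigma-z$. -/
theorem exists_mul_im_sub_re_pos {z : ℂ} (hz : z ∉ halfLines) {σ : ℝ} (hσ : σ = -1 ∨ σ = 1) :
    ∃ τ : ℝ, 0 < τ * (z.im - σ) - z.re := by
  by_cases hre : z.re < 0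
  · exact ⟨0, by linarith⟩
  · have him : z.im - σ ≠ 0 := fun h => hz ⟨not_lt.1 hre, by
      rcases hσ with rfl | rfl
      · exact Or.inl (by linarith)
      · exact Or.inr (by linarith)⟩
    refine ⟨(z.re + 1) / (z.im - σ), ?_⟩
    rw [div_mul_cancel₀ _ him]
    linarith

/-- Each side of the origin has its own good constant multiplier. A smooth interpolation $g$ between
them causes errors of size $(1+x^2)^{-1}$ only, and a positive integrable potential pays for them.
-/
theorem exists_isUnit_pencil {z : ℂ} (hz : z ∉ halfLines) :
    ∃ U : ℝ → ℂ, Integrable U ∧ IsUnit (pencil incl (formOp U) z) := by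
  obtain ⟨τ₁, h1⟩ := exists_mul_im_sub_re_pos hz (Or.inr rfl : (1 : ℝ) = -1 ∨ (1 : ℝ) = 1)
  obtain ⟨τ₂, h2⟩ := exists_mul_im_sub_re_pos hz (Or.inl rfl : (-1 : ℝ) = -1 ∨ (-1 : ℝ) = 1)
  -- Chosen so that $\alpha+\beta=\tau_1$ on the right and $\alpha-\beta=\tau_2$ on the left.
  set α := (τ₁ + τ₂) / 2 with hα
  set β := (τ₁ - τ₂) / 2 with hβ
  -- The first term pays for replacing the step by its smoothing, the second for $g'^2/2$.
  set κ := (|z.im| + 1) * |β| + β ^ 2 / 2 with hκ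
  have hU : Integrable fun x : ℝ => ((κ * (1 + x ^ 2)⁻¹ : ℝ) : ℂ) :=
    (integrable_inv_one_add_sq.const_mul κ).ofReal
  refine ⟨_, hU, ?_⟩
  set g : ℝ → ℝ := fun x => α + β * smoothStep x with hg
  have hgt : g.HasTemperateGrowth := by
    have := hasTemperateGrowth_smoothStep
    fun_prop
  have hderiv : ∀ x, deriv g x = β * deriv smoothStep x := fun x =>
    (((hasDerivAt_smoothStep x).differentiableAt.hasDerivAt.const_mul β).const_add α).deriv
  have hds : ∀ x, |deriv smoothStep x| ≤ 1 := fun x => by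
    refine abs_le_one_iff_mul_self_le_one.2 ?_
    rw [← sq]
    refine (deriv_smoothStep_sq_le x).trans (inv_le_one_of_one_le₀ ?_)
    nlinarith [sq_nonneg x]
  refine (hasPotential_pencil hU z).isUnit hgt (c := |α| + |β|) (d := |β|) (fun x => ?_)
    (fun x => ?_) (lt_min h1 h2) ?_
  · refine (abs_add_le _ _).trans (add_le_add le_rfl ?_)
    rw [abs_mul]
    exact mul_le_of_le_one_right (abs_nonneg _) (abs_smoothStep_le x)
  · rw [hderiv, Real.norm_eq_abs, abs_mul]
    exact mul_le_of_le_one_right (abs_nonneg _) (hds x)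
  · have hne : ∀ᵐ x : ℝ, x ≠ 0 := by
      simp [ae_iff]
    filter_upwards [hne] with x hx
    have hd2 := deriv_smoothStep_sq_le x
    have hss := abs_smoothStep_sub_sign_le hx
    set ρ := (1 + x ^ 2)⁻¹
    have hρ : 0 ≤ ρ := (sq_nonneg _).trans hd2
    have hre : (I * (Real.sign x : ℂ) - z + ((κ * ρ : ℝ) : ℂ)).re = -z.re + κ * ρ := by
      simp
    have him : (I * (Real.sign x : ℂ) - z + ((κ * ρ : ℝ) : ℂ)).im = Real.sign x - z.im := by
      simp
    rw [hre, him, hderiv, mul_pow]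
    have key : ∀ τ σ : ℝ, |σ| = 1 → τ = α + β * σ → |smoothStep x - σ| ≤ ρ →
        0 < τ * (z.im - σ) - z.re → (τ * (z.im - σ) - z.re) + β ^ 2 * deriv smoothStep x ^ 2 / 2 ≤
        -z.re + κ * ρ - g x * (σ - z.im) := by
      intro τ σ hσ hτ hs _
      have e1 : |(z.im - σ) * (β * (smoothStep x - σ))| ≤ (|z.im| + 1) * (|β| * ρ) := by
        rw [abs_mul, abs_mul]
        have := abs_sub z.im σ
        rw [hσ] at this
        gcongr
      have e2 := neg_le_of_abs_le e1
      have e3 : β ^ 2 * deriv smoothStep x ^ 2 ≤ β ^ 2 * ρ :=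
        mul_le_mul_of_nonneg_left hd2 (sq_nonneg _)
      rw [hτ, hκ, hg]
      dsimp only
      linarith [show (|z.im| + 1) * |β| * ρ = (|z.im| + 1) * (|β| * ρ) by ring,
        show (α + β * σ) * (z.im - σ) + (z.im - σ) * (β * (smoothStep x - σ)) =
          -((α + β * smoothStep x) * (σ - z.im)) by ring,
        show ((|z.im| + 1) * |β| + β ^ 2 / 2) * ρ = (|z.im| + 1) * (|β| * ρ) + β ^ 2 * ρ / 2 by ring]
    rcases lt_or_gt_of_ne hx with h | h
    · rw [Real.sign_of_neg h] at hss ⊢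
      have := key τ₂ (-1) (by simp) (by rw [hα, hβ]; ring) hss h2
      linarith [min_le_right (τ₁ * (z.im - 1) - z.re) (τ₂ * (z.im - -1) - z.re)]
    · rw [Real.sign_of_pos h] at hss ⊢
      have := key τ₁ 1 (by simp) (by rw [hα, hβ]; ring) hss h1
      linarith [min_le_left (τ₁ * (z.im - 1) - z.re) (τ₂ * (z.im - -1) - z.re)]

/-- Replace $W$ by the auxiliary $U$: the difference is a norm limit of finite rank operators, and a
small remainder is absorbed by the invertible part. -/
theorem exists_pencil_eq_add_finiteRank (W : ℝ → ℂ) {z : ℂ} (hz : z ∉ halfLines) :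
    ∃ C F : H1 →L[ℂ] H1, IsUnit C ∧ F ∈ finiteRank H1 ∧ pencil incl (formOp W) z = C + F := by
  obtain ⟨U, -, hU⟩ := exists_isUnit_pencil hz
  obtain ⟨C, F, hC, hF, h⟩ := exists_add_finiteRank hU
    (Submodule.sub_mem _ (potential_mem_closure W) (potential_mem_closure U))
  refine ⟨C, F, hC, hF, h ▸ ?_⟩
  unfold pencil formOp
  abel

/-- Far to the left, the shifted form is coercive. -/
theorem exists_isUnit_pencil_of_re_le {W : ℝ → ℂ} (hW : Integrable W) :
    ∃ t : ℝ, ∀ z : ℂ, z.re ≤ -t → IsUnit (pencil incl (formOp W) z) := by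
  set N := ∫ x, ‖W x‖ with hN
  have hN0 : 0 ≤ N := integral_nonneg fun _ => norm_nonneg _
  -- With $h=1/(4(N+1))$ the potential takes at most half of $\|p'\|^2$, at the price of
  -- $8N(N+1)\|p\|_{L^2}^2$. The other two summands pay for the step and for coercivity.
  refine ⟨8 * N * (N + 1) + ‖stepMul‖ + 1 / 2, fun z hz => ?_⟩
  refine isUnit_of_coercive (c := 1 / 2) one_half_pos fun p => ?_
  set h := 1 / (4 * (N + 1)) with hh
  have hpos : 0 < h := by positivity
  have e1 : ‖∫ x, W x * incl p x * starRingEnd ℂ (incl p x)‖ ≤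
      N * (2 / h * ‖incl p‖ ^ 2 + 2 * h * ‖der p‖ ^ 2) := by
    rw [← inner_potential hW]
    refine norm_inner_potential_le hW p p fun x => ?_
    rw [← sq]
    exact norm_eval_sq_le x hpos p
  have e2 : ‖inner ℂ (incl p) (stepMul (incl p))‖ ≤ ‖stepMul‖ * ‖incl p‖ ^ 2 := by
    refine (norm_inner_le_norm _ _).trans ?_
    have := stepMul.le_opNorm (incl p)
    nlinarith [norm_nonneg (incl p)]
  have e3 := neg_le_of_abs_le ((abs_re_le_norm _).trans e1)
  have e4 := neg_le_of_abs_le ((abs_re_le_norm _).trans e2)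
  have e5 : ∀ u : L2, inner ℂ u u = ((‖u‖ ^ 2 : ℝ) : ℂ) := fun u => by
    rw [inner_self_eq_norm_sq_to_K]
    push_cast
    rfl
  rw [pencil_apply, inner_sub_right, inner_smul_right, adjoint_inner_right, inner_formOp hW, e5,
    e5, sub_re, add_re, add_re, ofReal_re, re_mul_ofReal, norm_sq_eq]
  have e6 : 2 / h = 8 * (N + 1) := by rw [hh]; field_simp; norm_num
  have e7 : N * (2 * h) ≤ 1 / 2 := by
    rw [hh, ← mul_assoc, mul_one_div, div_le_iff₀ (by positivity)]
    linarith
  rw [e6] at e3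
  nlinarith [mul_le_mul_of_nonneg_right e7 (sq_nonneg ‖der p‖),
    mul_le_mul_of_nonneg_right hz (sq_nonneg ‖incl p‖)]

theorem mem_discreteSpectrum_of_notMem_halfLines {T : L2 →ₗ.[ℂ] L2} {W : ℝ → ℂ}
    (hW : Integrable W) (hT : IsAssociated T incl (formOp W)) {z : ℂ} (hz : z ∉ halfLines)
    (hzs : z ∈ UnboundedOp.spectrum T) : z ∈ UnboundedOp.discreteSpectrum T := by
  obtain ⟨C, F, hC, hF, hCF⟩ := exists_pencil_eq_add_finiteRank W hz
  refine hT.mem_discreteSpectrum incl_injective hC hF hCF hzs ?_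
  obtain ⟨t, ht⟩ := exists_isUnit_pencil_of_re_le hW
  -- Moving left from $z$ never meets a half-line, since both extend to the right, and eventually
  -- enters the region of coercivity.
  set s : Set ℂ := (fun a : ℝ => z - (a : ℂ)) '' Set.Ici 0
  have hs : IsPreconnected s := isPreconnected_Ici.image _ (by fun_prop)
  have hsub : ∀ w ∈ s, w ∉ halfLines := by
    rintro _ ⟨a, ha, rfl⟩ ⟨hre, him⟩
    simp only [sub_re, ofReal_re, sub_im, ofReal_im, sub_zero] at hre him
    exact hz ⟨by linarith [Set.mem_Ici.1 ha], him⟩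
  refine not_eventually_not_isUnit_pencil hs (fun w hw => exists_pencil_eq_add_finiteRank W
    (hsub w hw)) (z₀ := z - ((|z.re + t| : ℝ) : ℂ)) ⟨_, Set.mem_Ici.2 (abs_nonneg _), rfl⟩
    (ht _ ?_) ⟨0, Set.mem_Ici.2 le_rfl, by simp⟩
  rw [sub_re, ofReal_re]
  linarith [le_abs_self (z.re + t)]

end StepSchrodinger

namespace StepSchrodinger

open Filter Topology ContinuousLinearMap FormPencil H1

/-! ### Plane waves with slowly varying amplitude -/

/-- The wave `e^{ikx} g(tx)`. -/
def planeWave (k t : ℝ) (g : ℝ → ℝ) (x : ℝ) : ℂ := exp (I * k * x) * g (t * x)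

theorem hasDerivAt_planeWave (k t : ℝ) {g g' : ℝ → ℝ} (hg : ∀ x, HasDerivAt g (g' x) x) (x : ℝ) :
    HasDerivAt (planeWave k t g) (I * k * planeWave k t g x + t * planeWave k t g' x) x := by
  have h1 : HasDerivAt (fun x : ℝ => exp (I * k * x)) (exp (I * k * x) * (I * k)) x := by
    have := ((hasDerivAt_id x).ofReal_comp.const_mul (I * k)).cexp
    simpa using this
  have h2 : HasDerivAt (fun x : ℝ => g (t * x)) (g' (t * x) * t) x := by
    have h3 : HasDerivAt (fun x : ℝ => t * x) t x := by
      simpa using (hasDerivAt_id x).const_mul t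
    exact (hg (t * x)).comp x h3
  refine (h1.mul h2.ofReal_comp).congr_deriv ?_
  simp only [planeWave, ofReal_mul]
  ring

theorem norm_planeWave (k t : ℝ) (g : ℝ → ℝ) (x : ℝ) : ‖planeWave k t g x‖ = |g (t * x)| := by
  rw [planeWave, norm_mul, norm_real, Real.norm_eq_abs,
    show I * (k : ℂ) * x = ((k * x : ℝ) : ℂ) * I by push_cast; ring, norm_exp_ofReal_mul_I, one_mul]

theorem contDiff_planeWave (k t : ℝ) {g : ℝ → ℝ} (hg : ContDiff ℝ (⊤ : ℕ∞) g) :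
    ContDiff ℝ (⊤ : ℕ∞) (planeWave k t g) := by
  have h1 : ContDiff ℝ (⊤ : ℕ∞) fun x : ℝ => exp (I * k * x) :=
    (contDiff_const.mul ofRealCLM.contDiff).cexp
  have h2 : ContDiff ℝ (⊤ : ℕ∞) fun x : ℝ => ((g (t * x) : ℝ) : ℂ) :=
    ofRealCLM.contDiff.comp (hg.comp (contDiff_const.mul contDiff_id))
  exact h1.mul h2

theorem hasCompactSupport_planeWave (k : ℝ) {t : ℝ} (ht : t ≠ 0) {g : ℝ → ℝ}
    (hg : HasCompactSupport g) : HasCompactSupport (planeWave k t g) := by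
  have h1 : HasCompactSupport fun x : ℝ => g (t * x) :=
    hg.comp_homeomorph (Homeomorph.mulLeft₀ t ht)
  refine h1.mono fun x hx => ?_
  rw [Function.mem_support, ← norm_ne_zero_iff, norm_planeWave] at hx
  exact abs_ne_zero.1 hx

theorem norm_adjoint_incl_le (η : L2) : ‖adjoint incl η‖ ≤ ‖η‖ := by
  have h1 : ‖adjoint incl‖ ≤ 1 := by
    rw [LinearIsometryEquiv.norm_map]
    exact opNorm_le_bound _ zero_le_one fun p => by simpa using norm_incl_le p
  simpa using (adjoint incl).le_of_opNorm_le h1 η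

/-- Only the supremum of $f$ enters, so the potential contributes a bounded error even along waves
whose $L^2$ norm blows up. -/
theorem norm_potential_ofSchwartz_le {W : ℝ → ℂ} (hW : Integrable W) {f : 𝓢(ℝ, ℂ)}
    (hf : ∀ x, ‖f x‖ ≤ 1) : ‖potential W (ofSchwartz f)‖ ≤ 2 * ∫ x, ‖W x‖ := by
  set y := potential W (ofSchwartz f)
  have h := norm_inner_potential_le hW (ofSchwartz f) y (c := 2 * ‖y‖) fun x => by
    rw [eval_ofSchwartz]
    have h1 := norm_eval_apply_le x y
    have h2 := mul_le_mul (hf x) h1 (norm_nonneg _) zero_le_one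
    rwa [one_mul] at h2
  rw [inner_self_eq_norm_sq_to_K, ← RCLike.ofReal_pow, RCLike.norm_ofReal, abs_of_nonneg
    (sq_nonneg _)] at h
  rcases (norm_nonneg y).eq_or_lt with h0 | h0
  · rw [← h0]
    exact mul_nonneg zero_le_two (integral_nonneg fun _ => norm_nonneg _)
  · refine le_of_mul_le_mul_right ?_ h0
    linarith

/-- Singular sequences: slowly modulated plane waves on the half-line of sign `σ` show that
`k² + iσ` belongs to the spectrum. -/
theorem add_mem_spectrum {T : L2 →ₗ.[ℂ] L2} {W : ℝ → ℂ} (hW : Integrable W)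
    (hT : IsAssociated T incl (formOp W)) (k : ℝ) {σ : ℝ} (hσ : σ = -1 ∨ σ = 1) :
    ((k ^ 2 : ℝ) + σ * I : ℂ) ∈ UnboundedOp.spectrum T := by
  intro hres
  set z : ℂ := (k ^ 2 : ℝ) + σ * I with hz
  obtain ⟨t₀, ht₀⟩ := exists_isUnit_pencil_of_re_le hW
  obtain ⟨c, hc⟩ := hT.exists_norm_le (ht₀ (-t₀ : ℝ) (by simp)) hres
  -- Support of radius $1$ about $2\sigma$ stays on the side of sign $\sigma$ after every dilation
  -- by $t>0$, so the step potential acts there as the constant $i\sigma$.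
  let φ : ContDiffBump (2 * σ) := ⟨1 / 2, 1, by norm_num, by norm_num⟩
  have hφ : ContDiff ℝ (⊤ : ℕ∞) (φ : ℝ → ℝ) := φ.contDiff
  have hφ1 : ContDiff ℝ (⊤ : ℕ∞) (deriv φ) := (contDiff_infty_iff_deriv.1 hφ).2
  have hφ2 : ContDiff ℝ (⊤ : ℕ∞) (deriv (deriv φ)) := (contDiff_infty_iff_deriv.1 hφ1).2
  have hd1 : ∀ x, HasDerivAt φ (deriv φ x) x := fun x =>
    ((contDiff_infty_iff_deriv.1 hφ).1 x).hasDerivAt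
  have hd2 : ∀ x, HasDerivAt (deriv φ) (deriv (deriv φ) x) x := fun x =>
    ((contDiff_infty_iff_deriv.1 hφ1).1 x).hasDerivAt
  have hsupp : HasCompactSupport (φ : ℝ → ℝ) := φ.hasCompactSupport
  set G : ℝ → ℝ := fun y => (2 * |k| * |deriv φ y| + |deriv (deriv φ) y|) ^ 2 with hG
  have hGi : Integrable G := by
    refine Continuous.integrable_of_hasCompactSupport ?_ ?_
    · have := hφ1.continuous
      have := hφ2.continuous
      fun_prop
    · have hs := hsupp.deriv.deriv
      have hs1 := hsupp.deriv
      refine HasCompactSupport.comp_left (g := fun a : ℝ => a ^ 2) ?_ (by simp)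
      refine HasCompactSupport.add ?_ (hs.norm)
      exact HasCompactSupport.mul_left hs1.norm
  set A := ∫ y, φ y ^ 2 with hA
  have hA0 : 0 < A := by
    refine Continuous.integral_pos_of_hasCompactSupport_nonneg_nonzero (x := 2 * σ)
      (φ.continuous.pow 2) ?_ (fun _ => sq_nonneg _) ?_
    · exact hsupp.comp_left (g := fun a : ℝ => a ^ 2) (by simp)
    · have : φ (2 * σ) = 1 := φ.one_of_mem_closedBall (Metric.mem_closedBall_self φ.rIn_pos.le)
      simp [this]
  set N := ∫ x, ‖W x‖
  have hGnn : 0 ≤ ∫ y, G y := integral_nonneg fun _ => sq_nonneg _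
  have hN0 : 0 ≤ N := integral_nonneg fun _ => norm_nonneg _
  -- The wave is not normalized: its squared $L^2$ norm is $A/t$, while its image under the pencil
  -- stays bounded as $t\to0$. A boundedly solvable equation would not allow this.
  have main : ∀ t : ℝ, 0 < t → t ≤ 1 → A / t ≤ (c * (√(∫ y, G y) + 2 * N)) ^ 2 := by
    intro t ht ht1
    set f : 𝓢(ℝ, ℂ) := (hasCompactSupport_planeWave k ht.ne' hsupp).toSchwartzMap
      (contDiff_planeWave k t hφ) with hf
    have hfx : ∀ x, f x = planeWave k t φ x := fun x => rfl
    have hf1 : ∀ x, (∂_{(1 : ℝ)} f) x = I * k * planeWave k t φ x + t * planeWave k t (deriv φ) x :=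
      fun x => by
        rw [lineDeriv_one_apply]
        exact (hasDerivAt_planeWave k t hd1 x).deriv
    have hf2 : ∀ x, (∂_{(1 : ℝ)} (∂_{(1 : ℝ)} f)) x = -(k ^ 2 : ℝ) * planeWave k t φ x +
        (2 * I * k * t * planeWave k t (deriv φ) x + t ^ 2 * planeWave k t (deriv (deriv φ)) x) :=
      fun x => by
        rw [lineDeriv_one_apply]
        have h1 : ((∂_{(1 : ℝ)} f : 𝓢(ℝ, ℂ)) : ℝ → ℂ) = fun x =>
            I * k * planeWave k t φ x + t * planeWave k t (deriv φ) x := funext hf1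
        have h2 := ((hasDerivAt_planeWave k t hd1 x).const_mul (I * (k : ℂ))).add
          ((hasDerivAt_planeWave k t hd2 x).const_mul (t : ℂ))
        rw [h1]
        refine h2.deriv.trans ?_
        push_cast
        linear_combination (k ^ 2 * planeWave k t φ x : ℂ) * I_sq
    set p := ofSchwartz f with hp
    -- This is $(-\partial^2+i\,\mathrm{sgn}-z)f$, whose leading terms cancel; the potential is kept
    -- apart because its contribution is estimated only in the form domain.
    set η : L2 := -(∂_{(1 : ℝ)} (∂_{(1 : ℝ)} f)).toLp 2 volume +
      stepMul (f.toLp 2 volume) - z • f.toLp 2 volume with hη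
    have hpencil : pencil incl (formOp W) z p = adjoint incl η + potential W p := by
      refine ext_inner_left ℂ fun r => ?_
      rw [pencil_apply, inner_sub_right, inner_smul_right, adjoint_inner_right, inner_formOp hW,
        inner_add_right, adjoint_inner_right, inner_potential hW, hη, inner_sub_right,
        inner_add_right, inner_neg_right, inner_smul_right, hp, der_ofSchwartz, incl_ofSchwartz,
        inner_der_eq r (isWeakDeriv_toLp _)]
      ring
    have hηae : ∀ᵐ x, ‖η x‖ ^ 2 ≤ t ^ 2 * G (t * x) := by
      filter_upwards [Lp.coeFn_sub (-(∂_{(1 : ℝ)} (∂_{(1 : ℝ)} f)).toLp 2 volume +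
          stepMul (f.toLp 2 volume)) (z • f.toLp 2 volume),
        Lp.coeFn_add (-(∂_{(1 : ℝ)} (∂_{(1 : ℝ)} f)).toLp 2 volume) (stepMul (f.toLp 2 volume)),
        Lp.coeFn_neg ((∂_{(1 : ℝ)} (∂_{(1 : ℝ)} f)).toLp 2 volume),
        Lp.coeFn_smul z (f.toLp 2 volume), stepMul_ae (f.toLp 2 volume),
        (∂_{(1 : ℝ)} (∂_{(1 : ℝ)} f)).coeFn_toLp 2 volume, f.coeFn_toLp 2 volume]
        with x h1 h2 h3 h4 h5 h6 h7
      rw [hη, h1, Pi.sub_apply, h2, Pi.add_apply, h3, Pi.neg_apply, h4, Pi.smul_apply, h5, h6, h7,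
        hf2, hfx, smul_eq_mul]
      have hsign : (Real.sign x : ℂ) * planeWave k t φ x = σ * planeWave k t φ x := by
        by_cases h0 : planeWave k t φ x = 0
        · rw [h0, mul_zero, mul_zero]
        · have h8 : φ (t * x) ≠ 0 := by
            rw [← norm_eq_zero, norm_planeWave] at h0
            exact abs_ne_zero.1 h0
          have h9 : t * x ∈ Metric.ball (2 * σ) 1 := by
            rw [← Function.mem_support, φ.support_eq] at h8
            exact h8
          rw [Metric.mem_ball, Real.dist_eq, abs_lt] at h9
          rcases hσ with rfl | rfl
          · rw [Real.sign_of_neg (by nlinarith)]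
          · rw [Real.sign_of_pos (by nlinarith)]
      have heq : -(-(k ^ 2 : ℝ) * planeWave k t φ x + (2 * I * k * t * planeWave k t (deriv φ) x +
          t ^ 2 * planeWave k t (deriv (deriv φ)) x)) + I * (Real.sign x : ℂ) * planeWave k t φ x -
          z * planeWave k t φ x = -(2 * I * k * t * planeWave k t (deriv φ) x +
          t ^ 2 * planeWave k t (deriv (deriv φ)) x) := by
        rw [hz]
        linear_combination I * hsign
      rw [heq, norm_neg, ← mul_pow]
      refine pow_le_pow_left₀ (norm_nonneg _) ((norm_add_le _ _).trans ?_) 2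
      simp only [norm_mul, norm_pow, norm_planeWave, norm_real, norm_I, Real.norm_eq_abs,
        abs_of_pos ht, RCLike.norm_ofNat]
      nlinarith [mul_le_mul_of_nonneg_right ht1 (mul_nonneg ht.le (abs_nonneg
        (deriv (deriv φ) (t * x))))]
    have hηn : ‖η‖ ≤ √(∫ y, G y) := by
      refine Real.le_sqrt_of_sq_le ?_
      rw [norm_sq_eq_integral]
      refine (integral_mono_ae (integrable_norm_sq η)
        ((hGi.comp_mul_left' ht.ne').const_mul (t ^ 2)) hηae).trans ?_
      rw [integral_const_mul, Measure.integral_comp_mul_left, abs_of_pos (inv_pos.2 ht),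
        smul_eq_mul, ← mul_assoc, sq, mul_assoc t t, mul_inv_cancel₀ ht.ne', mul_one]
      exact mul_le_of_le_one_left hGnn ht1
    have hfn : ‖incl p‖ ^ 2 = A / t := by
      rw [hp, incl_ofSchwartz, norm_sq_eq_integral]
      have h1 : ∫ x, ‖(f.toLp 2 volume : L2) x‖ ^ 2 = ∫ x, φ (t * x) ^ 2 := by
        refine integral_congr_ae ?_
        filter_upwards [f.coeFn_toLp 2 volume] with x hx
        rw [hx, hfx, norm_planeWave, sq_abs]
      rw [h1, Measure.integral_comp_mul_left (fun y => φ y ^ 2), abs_of_pos (inv_pos.2 ht),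
        smul_eq_mul, div_eq_inv_mul]
    have hpot : ‖potential W p‖ ≤ 2 * N := norm_potential_ofSchwartz_le hW fun x => by
      rw [hfx, norm_planeWave, abs_of_nonneg φ.nonneg]
      exact φ.le_one
    rw [← hfn]
    have hle : ‖pencil incl (formOp W) z p‖ ≤ √(∫ y, G y) + 2 * N := by
      rw [hpencil]
      exact (norm_add_le _ _).trans (add_le_add ((norm_adjoint_incl_le η).trans hηn) hpot)
    have hcp := hc p
    rcases le_or_gt 0 c with hc0 | hc0
    · exact pow_le_pow_left₀ (norm_nonneg _)
        (hcp.trans (mul_le_mul_of_nonneg_left hle hc0)) 2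
    · have h0 : ‖incl p‖ = 0 := le_antisymm
        (hcp.trans (mul_nonpos_of_nonpos_of_nonneg hc0.le (norm_nonneg _))) (norm_nonneg _)
      rw [h0]
      exact (zero_pow two_ne_zero).trans_le (sq_nonneg _)
  set M := (c * (√(∫ y, G y) + 2 * N)) ^ 2
  have hM : 0 ≤ M := sq_nonneg _
  -- This $t$ is at most $1$ and gives $A/t=M+1+A$, which exceeds the bound $M$.
  have h := main (A / (M + 1 + A)) (by positivity) ((div_le_one (by positivity)).2 (by linarith))
  rw [div_div_cancel₀ hA0.ne'] at h
  linarith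

/-! ### Identification of the essential spectrum -/

theorem halfLines_subset_spectrum {T : L2 →ₗ.[ℂ] L2} {W : ℝ → ℂ} (hW : Integrable W)
    (hT : IsAssociated T incl (formOp W)) : halfLines ⊆ UnboundedOp.spectrum T := by
  rintro z ⟨hre, him⟩
  have h := add_mem_spectrum hW hT (√z.re) him
  rwa [Real.sq_sqrt hre, re_add_im] at h

/-- A shift to the right by $r/2$ stays on the half-line, so no ball isolates the point. -/
theorem notMem_discreteSpectrum {T : L2 →ₗ.[ℂ] L2} (hT : halfLines ⊆ UnboundedOp.spectrum T)
    {z : ℂ} (hz : z ∈ halfLines) : z ∉ UnboundedOp.discreteSpectrum T := by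
  rintro ⟨-, ⟨r, hr, hball⟩, -⟩
  have h1 : z + ((r / 2 : ℝ) : ℂ) ∈ UnboundedOp.spectrum T ∩ Metric.ball z r := by
    refine ⟨hT ⟨?_, ?_⟩, ?_⟩
    · rw [add_re, ofReal_re]
      linarith [hz.1]
    · rw [add_im, ofReal_im, add_zero]
      exact hz.2
    · rw [Metric.mem_ball, dist_eq_norm, add_sub_cancel_left, norm_real, Real.norm_eq_abs,
        abs_of_pos (half_pos hr)]
      linarith
  rw [hball, Set.mem_singleton_iff, add_eq_left, ofReal_eq_zero] at h1
  linarith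

theorem essentialSpectrum_eq_halfLines {T : L2 →ₗ.[ℂ] L2} {W : ℝ → ℂ} (hW : Integrable W)
    (hT : IsAssociated T incl (formOp W)) : UnboundedOp.essentialSpectrum T = halfLines := by
  have hsub := halfLines_subset_spectrum hW hT
  refine Set.Subset.antisymm (fun z hz => ?_) fun z hz => ⟨hsub hz, notMem_discreteSpectrum hsub hz⟩
  by_contra hzS
  exact hz.2 (mem_discreteSpectrum_of_notMem_halfLines hW hT hzS hz.1)

end StepSchrodinger

end

theorem proposition6 (V : ℝ → ℂ) (hV : MeasureTheory.Integrable V MeasureTheory.volume) (ε : ℝ) :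
    UnboundedOp.essentialSpectrum (StepSchrodinger.opHPert hV ε) =
      UnboundedOp.essentialSpectrum StepSchrodinger.opH ∧
    UnboundedOp.essentialSpectrum StepSchrodinger.opH =
      {z : ℂ | 0 ≤ z.re ∧ (z.im = -1 ∨ z.im = 1)} := by
  have h0 := StepSchrodinger.essentialSpectrum_eq_halfLines (MeasureTheory.integrable_zero _ _ _)
    StepSchrodinger.isAssociated_opH
  exact ⟨(StepSchrodinger.essentialSpectrum_eq_halfLines (hV.const_mul _)
    (StepSchrodinger.isAssociated_opHPert hV ε)).trans h0.symm, h0⟩
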